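/- **Conventions.** A function $F$ of a real variable is *fast decreasing* if $\lim_{n\to\infty}n^SF(n)=0$ for every $S>0$; $F\ge 0$ has *polynomial growth* if there are $c_1,c_2>0$ with $F(n)\le c_1n^{c_2}$ for all $n\ge 1$. The parameter $n$ is real. **Data space.** Let $(\mathbb X,\rho)$ be a connected metric space in which every closed ball $\mathbb B(x,r)$, $r>0$, is compact, and let $\mu^*$ be a positive $\sigma$-finite Borel measure on $\mathbb X$. Let $0=\lambda_0\le\lambda_1\le\cdots$, $\lambda_k\to\infty$, and let $\{\phi_k\}_{k\ge0}\subset L^1(\mu^*)\cap C_0(\mathbb X)$ be real-valued and orthonormal in $L^2(\mu^*)$, with $\phi_0>0$ everywhere and with linear span dense in $C_0(\mathbb X)$. Put $\Pi_n=\operatorname{span}\{\phi_k:\lambda_k<n\}$. Let $q\ge 1$ and assume: 1. there is $\kappa>0$ with $\mu^*(\mathbb B(x,r))=\mu^*(\{y:\rho(x,y)<r\})\le\kappa r^q$ for all $x\in\mathbb X$, $r>0$; 2. there are $\kappa_1,\kappa_2>0$ such that for all $x,y\in\mathbb X$, $0<t\le1$, the following series converges absolutely and $$\Big|\sum_{k=0}^\infty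 e^{-\lambda_k^2t}\phi_k(x)\phi_k(y)\Big|\le\kappa_1t^{-q/2}\exp\Big(-\kappa_2\frac{\rho(x,y)^2}{t}\Big);$$ 3. there are compact sets $\mathbb K_n\subset\mathbb X$, $n\ge1$, such that $\operatorname{diam}(\mathbb K_n)$ has polynomial growth, while $\sup_{x\in\mathbb X\setminus\mathbb K_n}\sum_{\lambda_k<n}\phi_k(x)^2$ and $\int_{\mathbb X\setminus\mathbb K_n}\big(\sum_{\lambda_k<n}\phi_k(x)^2\big)^{1/2}d\mu^*(x)$ are fast decreasing. **Kernels.** Let $h:\mathbb R\to[0,1]$ be $C^\infty$, even, non-increasing on $[0,\infty)$, with $h(t)=1$ for $|t|\le1/2$ and $h(t)=0$ for $t\ge1$, and let $\Phi_n(x,y)=\sum_kh(\lambda_k/n)\phi_k(x)\phi_k(y)$. Let $b:[0,\infty)\to(0,\infty)$ be non-increasing and $B^*\ge1$ be such that $t\mapsto b(B^*t)/b(t)$ is fast decreasing. Let $G:\mathbb X\times\mathbb X\to\mathbb R$ be a smooth kernel with mask $b$, i.e. there is a measurable $W:\mathbb X\to\mathbb R$ with $$W(y)G(x,y)=\sum_kb(\lambda_k)\phi_k(x)\phi_k(y),\qquad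 x,y\in\mathbb X.$$ For a finite signed Borel measure $\nu$ on $\mathbb X$ put $$\mathcal D_{G,n}(x,y)=\sum_kh(\lambda_k/n)\,b(\lambda_k)^{-1}\phi_k(x)\phi_k(y),\qquad \mathbb G_n(\nu;x,y)=\int_{\mathbb X}G(x,z)W(z)\mathcal D_{G,n}(z,y)\,d\nu(z).$$ **Quadrature.** Let $\{\nu_n\}_{n\ge1}$ be finite signed Borel measures on $\mathbb X$ forming an admissible product quadrature measure family: $|\nu_n|(\mathbb X)$ has polynomial growth, and $\int P_1P_2\,d\nu_n=\int P_1P_2\,d\mu^*$ for all $P_1,P_2\in\Pi_n$, $n\ge1$. (Measures $\nu_1,\nu_2,\dots$ satisfying these conditions for integer orders give such a family through $\nu_t:=\nu_{\lceil t\rceil}$.) **Theorem.** For all $n\ge1$ and $x,y\in\mathbb X$ the integral defining $\mathbb G_n(\nu_{B^*n};x,y)$ converges absolutely. For every $1\le p\le\infty$, $$n\mapsto\sup_{x\in\mathbb X}\big\|\mathbb G_n(\nu_{B^*n};x,\cdot)-\Phi_n(x,\cdot)\big\|_{L^p(\mu^*)}$$ is fast decreasing. Moreover, for every $S>0$ there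 is a constant $c(S)>0$, independent of $n,x,y$, such that for all $n\ge1$ and $x,y\in\mathbb X$ $$|\mathbb G_n(\nu_{B^*n};x,y)|\le c(S)\left\{\frac{n^q}{\max\big(1,(n\rho(x,y))^S\big)}+n^{-2S}\right\}.$$ -/

import Mathlib

open MeasureTheory Filter Topology
open scoped ENNReal ContDiff ZeroAtInfty

/-- `x ^ S * F x → 0` as `x → ∞`, for every `S > 0`. -/
def FastDecreasing (F : ℝ → ℝ) : Prop :=
  ∀ S : ℝ, 0 < S → Tendsto (fun x : ℝ => x ^ S * F x) atTop (𝓝 0)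

/-- Fast decrease of a nonnegative quantity (a supremum, a norm or an integral) that might a priori
be infinite. -/
def FastDecreasingENNReal (F : ℝ → ℝ≥0∞) : Prop :=
  ∀ S : ℝ, 0 < S → Tendsto (fun x : ℝ => ENNReal.ofReal (x ^ S) * F x) atTop (𝓝 0)

/-- A bound `F n ≤ c₁ n ^ c₂` for all `n ≥ 1`, for a nonnegative quantity `F`. -/
def PolynomialGrowth (F : ℝ → ℝ≥0∞) : Prop :=
  ∃ c₁ c₂ : ℝ, 0 < c₁ ∧ 0 < c₂ ∧ ∀ n : ℝ, 1 ≤ n → F n ≤ ENNReal.ofReal (c₁ * n ^ c₂)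

/-- A measure `μ` on `X`, a sequence `0 = λ₀ ≤ λ₁ ≤ ⋯ → ∞`, and a `μ`-orthonormal system of
functions `φₖ ∈ L¹(μ) ∩ C₀(X)` with `φ₀ > 0` whose linear span is dense in `C₀(X)`. On a metric
space, the elements of `C₀(X, ℝ)` are automatically uniformly continuous. -/
structure SpectralSystem (X : Type*) [MetricSpace X] [MeasurableSpace X] where
  μ : Measure X
  lam : ℕ → ℝ
  φ : ℕ → C₀(X, ℝ)
  sigmaFinite : SigmaFinite μ
  lam_mono : Monotone lam
  lam_zero : lam 0 = 0
  lam_tendsto : Tendsto lam atTop atTop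
  φ_integrable : ∀ k, Integrable (φ k) μ
  φ_orthonormal : ∀ j k, ∫ x, φ j x * φ k x ∂μ = if j = k then 1 else 0
  φ_zero_pos : ∀ x, 0 < φ 0 x
  dense_span : Dense (Submodule.span ℝ (Set.range φ) : Set C₀(X, ℝ))

namespace SpectralSystem

variable {X : Type*} [MetricSpace X] [MeasurableSpace X] (Ξ : SpectralSystem X)

theorem finite_lam_lt (n : ℝ) : {k : ℕ | Ξ.lam k < n}.Finite := by
  have h : ∀ᶠ k in cofinite, n ≤ Ξ.lam k := by
    rw [Nat.cofinite_eq_atTop]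
    exact Ξ.lam_tendsto.eventually_ge_atTop n
  simpa [Filter.eventually_cofinite] using h

/-- The finite set of indices `k` with `λₖ < n`. -/
noncomputable def lowIndices (n : ℝ) : Finset ℕ := (Ξ.finite_lam_lt n).toFinset

/-- The space of diffusion polynomials `Πₙ = span {φₖ : λₖ < n}`. -/
def diffusionPoly (n : ℝ) : Submodule ℝ C₀(X, ℝ) :=
  Submodule.span ℝ (Ξ.φ '' {k | Ξ.lam k < n})

/-- `∑_{λₖ < n} φₖ(x)²`. -/
noncomputable def christoffel (n : ℝ) (x : X) : ℝ := ∑ k ∈ Ξ.lowIndices n, Ξ.φ k x ^ 2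

/-- The conditions, with exponent `q`, under which the system is a data space. -/
structure IsDataSpace (q : ℝ) : Prop where
  one_le_q : 1 ≤ q
  isCompact_closedBall : ∀ (x : X) (r : ℝ), 0 < r → IsCompact (Metric.closedBall x r)
  ball_measure : ∃ κ : ℝ, 0 < κ ∧ ∀ (x : X) (r : ℝ), 0 < r →
    Ξ.μ (Metric.closedBall x r) = Ξ.μ (Metric.ball x r) ∧
    Ξ.μ (Metric.closedBall x r) ≤ ENNReal.ofReal (κ * r ^ q)
  gaussian_bound : ∃ κ₁ κ₂ : ℝ, 0 < κ₁ ∧ 0 < κ₂ ∧ ∀ (x y : X) (t : ℝ), 0 < t → t ≤ 1 →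
    Summable (fun k => Real.exp (-(Ξ.lam k ^ 2 * t)) * Ξ.φ k x * Ξ.φ k y) ∧
    |∑' k, Real.exp (-(Ξ.lam k ^ 2 * t)) * Ξ.φ k x * Ξ.φ k y| ≤
      κ₁ * t ^ (-q / 2) * Real.exp (-(κ₂ * (dist x y ^ 2 / t)))
  essential_compactness : ∃ K : ℝ → Set X,
    (∀ n : ℝ, 1 ≤ n → IsCompact (K n)) ∧
    PolynomialGrowth (fun n => ENNReal.ofReal (Metric.diam (K n))) ∧
    FastDecreasingENNReal
      (fun n => ⨆ x ∈ (K n)ᶜ, ENNReal.ofReal (Ξ.christoffel n x)) ∧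
    FastDecreasingENNReal
      (fun n => ∫⁻ x in (K n)ᶜ, ENNReal.ofReal (Real.sqrt (Ξ.christoffel n x)) ∂Ξ.μ)

/-- `Φₙ(x, y) = ∑ₖ h(λₖ / n) φₖ(x) φₖ(y)`; for `h` vanishing on `[1, ∞)` and `n > 0` this is a
finite sum. -/
noncomputable def locKernel (h : ℝ → ℝ) (n : ℝ) (x y : X) : ℝ :=
  ∑' k, h (Ξ.lam k / n) * Ξ.φ k x * Ξ.φ k y

/-- A family of finite signed measures `νₙ`, one for each order `n ≥ 1`, whose total variations grow
polynomially and such that `νₙ` integrates products of elements of `Πₙ` exactly as `μ` does. -/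
structure IsAdmissibleProductQuadrature (ν : ℝ → SignedMeasure X) : Prop where
  growth : PolynomialGrowth (fun n => (ν n).variation Set.univ)
  quadrature : ∀ n : ℝ, 1 ≤ n → ∀ P₁ ∈ Ξ.diffusionPoly n, ∀ P₂ ∈ Ξ.diffusionPoly n,
    ∫ᵛ x, P₁ x * P₂ x ∂•(ν n) = ∫ x, P₁ x * P₂ x ∂Ξ.μ

end SpectralSystem

/-- The low-pass filter `h : ℝ → [0, 1]`. -/
structure IsLowPassFilter (h : ℝ → ℝ) : Prop where
  contDiff : ContDiff ℝ ∞ h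
  nonneg : ∀ t, 0 ≤ h t
  le_one : ∀ t, h t ≤ 1
  even : ∀ t, h (-t) = h t
  antitoneOn : AntitoneOn h (Set.Ici 0)
  eq_one : ∀ t, |t| ≤ 1 / 2 → h t = 1
  eq_zero : ∀ t, 1 ≤ t → h t = 0

/-- `b : [0, ∞) → (0, ∞)` is a smooth mask with dilation constant `B`. -/
structure IsSmoothMask (b : ℝ → ℝ) (B : ℝ) : Prop where
  pos : ∀ t, 0 ≤ t → 0 < b t
  antitoneOn : AntitoneOn b (Set.Ici 0)
  one_le : 1 ≤ B
  fastDecreasing : FastDecreasing (fun t => b (B * t) / b t)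

namespace SpectralSystem

variable {X : Type*} [MetricSpace X] [MeasurableSpace X] (Ξ : SpectralSystem X)

/-- `G` is a smooth kernel, with weight `W`, smooth mask `b` and dilation constant `B` of `b`. -/
structure IsSmoothKernel (G : X → X → ℝ) (W : X → ℝ) (b : ℝ → ℝ) (B : ℝ) : Prop where
  mask : IsSmoothMask b B
  measurable_weight : Measurable W
  expansion : ∀ x y : X,
    HasSum (fun k => b (Ξ.lam k) * Ξ.φ k x * Ξ.φ k y) (W y * G x y)

/-- `D_{G,n}(x, y) = ∑ₖ h(λₖ / n) b(λₖ)⁻¹ φₖ(x) φₖ(y)`, again a finite sum. -/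
noncomputable def inverseKernel (h b : ℝ → ℝ) (n : ℝ) (x y : X) : ℝ :=
  ∑' k, h (Ξ.lam k / n) * (b (Ξ.lam k))⁻¹ * Ξ.φ k x * Ξ.φ k y

/-- The pre-fabricated eignet `𝔾ₙ(ν; x, y) = ∫ G(x, z) W(z) D_{G,n}(z, y) dν(z)`. -/
noncomputable def eignetKernel (h b : ℝ → ℝ) (G : X → X → ℝ) (W : X → ℝ) (n : ℝ)
    (ν : SignedMeasure X) (x y : X) : ℝ :=
  ∫ᵛ z, G x z * W z * Ξ.inverseKernel h b n z y ∂•ν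

end SpectralSystem

/-! Split `G x z * W z` at frequency `B * n`. The low part, integrated against `inverseKernel`,
involves only products of elements of the space of order `B * n`, so exact quadrature and
orthonormality reproduce `locKernel`. The high part is small relative to `b n` by the mask decay
(`exists_abs_tail_le`), while `inverseKernel` grows no faster than `(b n)⁻¹` times Christoffel
factors (`abs_inverseKernel_le`). These powers of `b n` cancel, and the fast decay absorbs the
polynomial growth of the total variation. The error is thus any negative power of `n` times
`√(christoffel n y)`, uniformly in `x` (`exists_abs_eignetKernel_sub_le`). That root has
polynomially growing supremum and `L¹` norm, hence the `Lᵖ` statement.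

The pointwise bound then reduces to localization of `locKernel` (`exists_abs_locKernel_le`). With `w
= exp (-t ^ 2)`, the filter is `w` times a rapidly convergent series in `T_m (2 * w - 1)`. Degrees
below `N` give combinations of heat kernels at times `i / n ^ 2`, `1 ≤ i ≤ N`: their Gaussian decay
beats the coefficient growth `7 ^ N` when `N` is a small multiple of `n * dist x y`. The remaining
degrees contribute `N ^ (-j)` for any fixed `j`. -/

/-! ### Rapidly convergent cosine series -/

theorem norm_fourierCoeffOn_le_integral {T : ℝ} (hT : 0 < T) (f : ℝ → ℂ) (n : ℤ) :
    ‖fourierCoeffOn hT f n‖ ≤ (1 / T) * ∫ x in (0 : ℝ)..T, ‖f x‖ := by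
  rw [fourierCoeffOn_eq_integral, norm_smul, sub_zero, Real.norm_of_nonneg (by positivity)]
  gcongr
  refine (intervalIntegral.norm_integral_le_integral_norm hT.le).trans_eq ?_
  congr 1 with x
  rw [norm_smul, fourier_apply, Circle.norm_coe, one_mul]

/-- The Fourier coefficients of a smooth periodic function decrease rapidly. -/
theorem exists_fourierCoeffOn_mul_pow_le {T : ℝ} (hT : 0 < T) (j : ℕ) :
    ∀ f : ℝ → ℂ, ContDiff ℝ ∞ f → f.Periodic T →
      ∃ C : ℝ, ∀ m : ℤ, ‖fourierCoeffOn hT f m‖ * |(m : ℝ)| ^ j ≤ C := by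
  induction j with
  | zero =>
    intro f hf hp
    exact ⟨_, fun m => by simpa using norm_fourierCoeffOn_le_integral hT f m⟩
  | succ j ih =>
    intro f hf hp
    have hd : ContDiff ℝ ∞ (deriv f) := (contDiff_infty_iff_deriv.1 hf).2
    have hdp : (deriv f).Periodic T := fun x => by
      have : deriv (fun y => f (y + T)) x = deriv f (x + T) := deriv_comp_add_const ..
      rw [← this]
      congr 1
      ext y
      exact hp y
    obtain ⟨C, hC⟩ := ih (deriv f) hd hdp
    refine ⟨T / (2 * Real.pi) * C, fun m => ?_⟩
    rcases eq_or_ne m 0 with rfl | hm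
    · have h0 := (mul_nonneg (norm_nonneg _) (by positivity)).trans (hC 0)
      have := Real.pi_pos
      simpa using by positivity
    have hm' : 0 < |(m : ℝ)| := by positivity
    rw [fourierCoeffOn_of_hasDerivAt hT hm
      (fun x _ => (hf.differentiable (by simp) x).hasDerivAt)
      (hd.continuous.intervalIntegrable _ _)]
    -- Periodicity kills the boundary term of the integration by parts, so each derivative gains one
    -- factor `1 / |m|`.
    have h0 : f T - f 0 = 0 := by simpa [sub_eq_zero] using hp 0
    rw [h0, mul_zero, zero_sub, norm_mul, norm_neg, norm_mul, norm_div, norm_mul, norm_mul, norm_mul]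
    simp only [norm_one, norm_neg, Complex.norm_I, Complex.norm_intCast, Complex.norm_real,
      Complex.norm_ofNat, Real.norm_eq_abs, abs_of_pos Real.pi_pos, mul_one, Complex.ofReal_zero,
      sub_zero, abs_of_pos hT]
    calc _ = T / (2 * Real.pi) * (‖fourierCoeffOn hT (deriv f) m‖ * |(m : ℝ)| ^ j) := by
          have := Real.pi_pos
          field_simp
          ring
      _ ≤ _ := by
          have := Real.pi_pos
          gcongr
          exact hC m

/-- Comparison with `1 / m ^ 2`; the hypothesis says nothing at `m = 0`, so that single term is
replaced by zero. -/
theorem summable_of_mul_abs_pow_two_le {c : ℤ → ℝ} {C : ℝ} (hc : ∀ m, 0 ≤ c m)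
    (h : ∀ m : ℤ, c m * |(m : ℝ)| ^ 2 ≤ C) : Summable c := by
  have h1 : Summable fun m : ℤ => C * (1 / (m : ℝ) ^ 2) :=
    ((Real.summable_one_div_int_pow (p := 2)).2 (by norm_num)).mul_left C
  refine (summable_congr_cofinite ?_).1
    ((Summable.of_nonneg_of_le (fun m => ?_) (fun m => ?_) h1 :
      Summable fun m : ℤ => if m = 0 then 0 else c m))
  · have : ∀ᶠ m : ℤ in cofinite, m ∉ ({0} : Set ℤ) :=
      (Set.finite_singleton (0 : ℤ)).eventually_cofinite_notMem
    filter_upwards [this] with m hm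
    simp at hm
    simp [hm]
  · split_ifs
    exacts [le_rfl, hc m]
  · split_ifs with hm
    · simp [hm]
    · have : (0 : ℝ) < (m : ℝ) ^ 2 := by positivity
      rw [mul_one_div, le_div_iff₀ this]
      simpa using h m

/-- A smooth even `2π`-periodic function is the sum of a rapidly converging cosine series. -/
theorem exists_hasSum_cos {F : ℝ → ℝ} (hF : ContDiff ℝ ∞ F) (hp : F.Periodic (2 * Real.pi))
    (he : ∀ θ, F (-θ) = F θ) :
    ∃ a : ℤ → ℝ, (∀ j : ℕ, Summable fun m => |a m| * |(m : ℝ)| ^ j) ∧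
      ∀ θ, HasSum (fun m => a m * Real.cos (m * θ)) (F θ) := by
  have hT : 0 < 2 * Real.pi := by positivity
  have : Fact (0 < 2 * Real.pi - 0) := ⟨by simpa using hT⟩
  set f : ℝ → ℂ := fun θ => (F θ : ℂ) with hfdef
  have hf : ContDiff ℝ ∞ f := Complex.ofRealCLM.contDiff.comp hF
  have hfp : f.Periodic (2 * Real.pi - 0) := fun θ => by simp [hfdef, hp θ]
  let g : C(AddCircle (2 * Real.pi - 0), ℂ) := ⟨hfp.lift, hf.continuous.quotient_lift _⟩
  have hg : fourierCoeff g = fourierCoeffOn hT f := by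
    ext m
    rw [fourierCoeffOn_eq_integral, fourierCoeff_eq_intervalIntegral _ _ 0]
    simp only [zero_add]
    congr 2
    simp
  have hfp' : f.Periodic (2 * Real.pi) := by simpa using hfp
  have hdecay (j : ℕ) : Summable fun m : ℤ => ‖fourierCoeffOn hT f m‖ * |(m : ℝ)| ^ j := by
    obtain ⟨C, hC⟩ := exists_fourierCoeffOn_mul_pow_le hT (j + 2) f hf hfp'
    refine summable_of_mul_abs_pow_two_le (C := C) (fun m => by positivity) fun m => ?_
    rw [mul_assoc, ← pow_add]
    exact hC m
  have hs : Summable (fourierCoeff g) := by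
    rw [hg]
    exact Summable.of_norm (by simpa using hdecay 0)
  refine ⟨fun m => (fourierCoeffOn hT f m).re, fun j => ?_, fun θ => ?_⟩
  · refine Summable.of_nonneg_of_le (fun m => by positivity) (fun m => ?_) (hdecay j)
    gcongr
    exact Complex.abs_re_le_norm _
  have key (θ : ℝ) : HasSum (fun m : ℤ => fourierCoeffOn hT f m *
      Complex.exp (Complex.I * (m * θ : ℝ))) (F θ : ℂ) := by
    have h := has_pointwise_sum_fourier_series_of_summable hs (θ : AddCircle (2 * Real.pi - 0))
    rw [hg] at h
    have h2 : g (θ : AddCircle (2 * Real.pi - 0)) = (F θ : ℂ) := rfl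
    rw [h2] at h
    convert! h using 2 with m
    rw [smul_eq_mul, fourier_coe_apply]
    congr 2
    push_cast
    have : (Real.pi : ℂ) ≠ 0 := by exact_mod_cast Real.pi_ne_zero
    field_simp
    ring
  -- Evenness: averaging the series at `θ` and `-θ` turns exponentials into cosines.
  have h1 := (key θ).add (key (-θ))
  have h2 := Complex.hasSum_re (h1.mul_left (1 / 2))
  convert! h2 using 1
  · ext m
    have : (m : ℝ) * -θ = -(m * θ) := by ring
    rw [← mul_add, this, mul_comm Complex.I, mul_comm Complex.I, Complex.ofReal_neg]
    have h3 : Complex.exp (((m * θ : ℝ) : ℂ) * Complex.I) +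
        Complex.exp (-((m * θ : ℝ) : ℂ) * Complex.I) = 2 * ((Real.cos (m * θ) : ℝ) : ℂ) := by
      rw [Complex.ofReal_cos, Complex.cos]
      ring
    rw [h3, show (1 / 2 : ℂ) * (fourierCoeffOn hT f m * (2 * ((Real.cos (m * θ) : ℝ) : ℂ))) =
      fourierCoeffOn hT f m * ((Real.cos (m * θ) : ℝ) : ℂ) by ring, Complex.re_mul_ofReal]
  · rw [he, ← two_mul, ← mul_assoc]
    norm_num

/-! ### Chebyshev expansion of the filter -/

namespace IsLowPassFilter

variable {h : ℝ → ℝ} (hh : IsLowPassFilter h)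

include hh

/-- The singularity of the square root at `0` is harmless because `h` is constant on `[0, 1 / 2]`;
negative `s` have `√s = 0`. -/
theorem contDiff_comp_sqrt : ContDiff ℝ ∞ fun s => h (√s) := by
  rw [contDiff_iff_contDiffAt]
  intro s
  rcases lt_or_ge 0 s with hs | hs
  · exact hh.contDiff.contDiffAt.comp s (Real.contDiffAt_sqrt hs.ne')
  · refine (contDiffAt_const (c := (1 : ℝ))).congr_of_eventuallyEq ?_
    filter_upwards [gt_mem_nhds (show s < 1 / 4 by linarith)] with u hu
    refine hh.eq_one _ ?_
    rw [abs_of_nonneg (Real.sqrt_nonneg _)]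
    exact Real.sqrt_le_iff.2 ⟨by norm_num, by linarith⟩

/-- This is `h t / exp (-t ^ 2)` under the substitution `exp (-t ^ 2) = cos (θ / 2) ^ 2`. Dividing
by the exponential reserves one Gaussian factor in every later term, so that only heat kernels at
positive times occur. The zeros of the cosine correspond to `t = ∞`, where `h` vanishes. -/
theorem contDiff_pullback :
    ContDiff ℝ ∞ fun θ => h (√(-Real.log (Real.cos (θ / 2) ^ 2))) / Real.cos (θ / 2) ^ 2 := by
  have hc : ContDiff ℝ ∞ fun θ : ℝ => Real.cos (θ / 2) ^ 2 :=
    (Real.contDiff_cos.comp (contDiff_id.div_const 2)).pow 2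
  rw [contDiff_iff_contDiffAt]
  intro θ
  by_cases h0 : Real.cos (θ / 2) ^ 2 = 0
  · refine (contDiffAt_const (c := (0 : ℝ))).congr_of_eventuallyEq ?_
    have : ∀ᶠ u in 𝓝 θ, Real.cos (u / 2) ^ 2 < Real.exp (-1) :=
      hc.continuous.continuousAt.eventually_lt continuousAt_const (by
        rw [h0]
        exact Real.exp_pos _)
    filter_upwards [this] with u hu
    -- At an exact zero of the cosine, the value is `0` by the convention for division by zero.
    rcases (sq_nonneg (Real.cos (u / 2))).eq_or_lt with h1 | h1
    · simp [← h1]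
    · have h2 : Real.log (Real.cos (u / 2) ^ 2) < -1 := by
        rwa [Real.log_lt_iff_lt_exp h1]
      rw [hh.eq_zero, zero_div]
      exact Real.le_sqrt_of_sq_le (by linarith)
  · exact (hh.contDiff_comp_sqrt.contDiffAt.comp θ
      (hc.contDiffAt.log h0).neg).div hc.contDiffAt h0

/-- Expansion of a low-pass filter, in the variable `exp (-t ^ 2)`, into a rapidly converging series
of shifted Chebyshev polynomials. -/
theorem exists_hasSum_chebyshev :
    ∃ a : ℤ → ℝ, (∀ j : ℕ, Summable fun m => |a m| * |(m : ℝ)| ^ j) ∧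
      ∀ t, 0 ≤ t → HasSum (fun m => a m * (Real.exp (-t ^ 2) *
        (Polynomial.Chebyshev.T ℝ m).eval (2 * Real.exp (-t ^ 2) - 1))) (h t) := by
  obtain ⟨a, ha, hsum⟩ := exists_hasSum_cos hh.contDiff_pullback
    (fun θ => by
      simp only [add_div, mul_div_cancel_left₀ Real.pi two_ne_zero, Real.cos_add_pi, neg_sq])
    (fun θ => by simp only [neg_div, Real.cos_neg])
  refine ⟨a, ha, fun t ht => ?_⟩
  have hpos := Real.exp_pos (-t ^ 2)
  have hle : Real.exp (-t ^ 2) ≤ 1 := Real.exp_le_one_iff.2 (by nlinarith)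
  have hcos : Real.cos (Real.arccos (2 * Real.exp (-t ^ 2) - 1)) = 2 * Real.exp (-t ^ 2) - 1 :=
    Real.cos_arccos (by linarith) (by linarith)
  have hcos2 : Real.cos (Real.arccos (2 * Real.exp (-t ^ 2) - 1) / 2) ^ 2 = Real.exp (-t ^ 2) := by
    rw [Real.cos_sq, mul_div_cancel₀ _ two_ne_zero, hcos]
    ring
  have := (hsum (Real.arccos (2 * Real.exp (-t ^ 2) - 1))).mul_left (Real.exp (-t ^ 2))
  rw [hcos2, Real.log_exp, neg_neg, Real.sqrt_sq ht, mul_div_cancel₀ _ hpos.ne'] at this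
  convert! this using 2 with m
  rw [← Polynomial.Chebyshev.T_real_cos, hcos]
  ring

end IsLowPassFilter

/-! ### Spectral multipliers from Gaussian moments -/

/-- If the moments `∑ wₖ ^ i cₖ` are bounded by `M` for `1 ≤ i ≤ N`, then so are, up to a
geometric factor, the sums `∑ wₖ ^ i Tₘ(2 wₖ - 1) cₖ`. -/
theorem abs_tsum_chebyshev_le {w c : ℕ → ℝ} (hw0 : ∀ k, 0 ≤ w k) (hw1 : ∀ k, w k ≤ 1)
    (hs : Summable fun k => w k * |c k|) {N : ℕ} {M : ℝ}
    (hM : ∀ i, 1 ≤ i → i ≤ N → |∑' k, w k ^ i * c k| ≤ M) (m : ℕ) :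
    ∀ i, 1 ≤ i → i + m ≤ N →
      |∑' k, w k ^ i * (Polynomial.Chebyshev.T ℝ m).eval (2 * w k - 1) * c k| ≤ 7 ^ m * M := by
  have hsum (m i : ℕ) (hi : 1 ≤ i) : Summable fun k =>
      w k ^ i * (Polynomial.Chebyshev.T ℝ m).eval (2 * w k - 1) * c k := by
    refine Summable.of_norm_bounded hs fun k => ?_
    have h1 : |(Polynomial.Chebyshev.T ℝ m).eval (2 * w k - 1)| ≤ 1 :=
      Polynomial.Chebyshev.abs_eval_T_real_le_one _
        (abs_le.2 ⟨by linarith [hw0 k], by linarith [hw1 k]⟩)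
    have h2 : w k ^ i ≤ w k := pow_le_of_le_one (hw0 k) (hw1 k) (by omega)
    rw [norm_mul, norm_mul, Real.norm_eq_abs, Real.norm_eq_abs, Real.norm_eq_abs,
      abs_of_nonneg (pow_nonneg (hw0 k) _)]
    gcongr
    calc _ ≤ w k ^ i * 1 := by
          gcongr
          exact pow_nonneg (hw0 k) _
      _ ≤ w k := by rwa [mul_one]
  induction m using Nat.twoStepInduction with
  | zero =>
    intro i hi hN
    simpa using hM i hi (by omega)
  | one =>
    intro i hi hN
    have h1 := hM i hi (by omega)
    have h2 := hM (i + 1) (by omega) (by omega)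
    have s1 := hsum 0 i hi
    have s2 := hsum 0 (i + 1) (by omega)
    simp only [Nat.cast_zero, Polynomial.Chebyshev.T_zero, Polynomial.eval_one, mul_one] at s1 s2
    have : ∑' k, w k ^ i * (Polynomial.Chebyshev.T ℝ (1 : ℕ)).eval (2 * w k - 1) * c k =
        2 * ∑' k, w k ^ (i + 1) * c k - ∑' k, w k ^ i * c k := by
      rw [← tsum_mul_left, ← (s2.mul_left 2).tsum_sub s1]
      refine tsum_congr fun k => ?_
      simp only [Nat.cast_one, Polynomial.Chebyshev.T_one, Polynomial.eval_X]
      ring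
    rw [this]
    rw [abs_le] at h1 h2 ⊢
    constructor <;> linarith
  | more m ih1 ih2 =>
    intro i hi hN
    have h1 := ih1 i hi (by omega)
    have h2 := ih2 i hi (by omega)
    have h3 := ih2 (i + 1) (by omega) (by omega)
    have : ∑' k, w k ^ i * (Polynomial.Chebyshev.T ℝ (m + 2 : ℕ)).eval (2 * w k - 1) * c k =
        4 * (∑' k, w k ^ (i + 1) *
          (Polynomial.Chebyshev.T ℝ (m + 1 : ℕ)).eval (2 * w k - 1) * c k) -
        2 * (∑' k, w k ^ i * (Polynomial.Chebyshev.T ℝ (m + 1 : ℕ)).eval (2 * w k - 1) * c k) -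
        ∑' k, w k ^ i * (Polynomial.Chebyshev.T ℝ (m : ℕ)).eval (2 * w k - 1) * c k := by
      rw [← tsum_mul_left, ← tsum_mul_left,
        ← ((hsum (m + 1) (i + 1) (by omega)).mul_left 4).tsum_sub
          ((hsum (m + 1) i hi).mul_left 2),
        ← (((hsum (m + 1) (i + 1) (by omega)).mul_left 4).sub
          ((hsum (m + 1) i hi).mul_left 2)).tsum_sub (hsum m i hi)]
      refine tsum_congr fun k => ?_
      have : (Polynomial.Chebyshev.T ℝ (m + 2 : ℕ)).eval (2 * w k - 1) =
          2 * (2 * w k - 1) * (Polynomial.Chebyshev.T ℝ (m + 1 : ℕ)).eval (2 * w k - 1) -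
            (Polynomial.Chebyshev.T ℝ (m : ℕ)).eval (2 * w k - 1) := by
        have := Polynomial.Chebyshev.T_add_two ℝ m
        push_cast
        rw [this]
        simp
      rw [this]
      ring
    rw [this]
    -- The base `7` works because `4 * 7 + 2 * 7 + 1 ≤ 7 ^ 2`. Multiplication by `w` in the
    -- recurrence raises `i` by one, which is why `i + m ≤ N` is the right constraint.
    have hpos : 0 ≤ 7 ^ m * M := (abs_nonneg _).trans h1
    rw [pow_succ] at h2 h3
    rw [pow_succ, pow_succ]
    rw [abs_le] at h1 h2 h3 ⊢
    constructor <;> linarith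

/-- Control of a spectral multiplier series by finitely many Gaussian moments. -/
theorem IsLowPassFilter.exists_abs_tsum_le {h : ℝ → ℝ} (hh : IsLowPassFilter h) (j : ℕ) :
    ∃ A : ℝ, 0 < A ∧ ∀ (t c : ℕ → ℝ) (N : ℕ) (M D : ℝ), 0 < N → (∀ k, 0 ≤ t k) →
      (Summable fun k => Real.exp (-t k ^ 2) * |c k|) →
      ∑' k, Real.exp (-t k ^ 2) * |c k| ≤ D →
      (∀ i, 1 ≤ i → i ≤ N → |∑' k, Real.exp (-t k ^ 2) ^ i * c k| ≤ M) →
      |∑' k, h (t k) * c k| ≤ A * (7 ^ N * M + D / N ^ j) := by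
  obtain ⟨a, ha, hsum⟩ := hh.exists_hasSum_chebyshev
  have ha0 : Summable fun m => |a m| := by simpa using ha 0
  set A₀ := ∑' m, |a m| with hA₀
  set A₁ := ∑' m, |a m| * |(m : ℝ)| ^ j with hA₁
  have hA₀0 : 0 ≤ A₀ := tsum_nonneg fun m => abs_nonneg _
  have hA₁0 : 0 ≤ A₁ := tsum_nonneg fun m => by positivity
  refine ⟨A₀ + A₁ + 1, by positivity, fun t c N M D hN ht hs hD hM => ?_⟩
  have hM0 : 0 ≤ M := (abs_nonneg _).trans (hM 1 le_rfl hN)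
  have hD0 : 0 ≤ D := (tsum_nonneg fun k => by positivity).trans hD
  set w : ℕ → ℝ := fun k => Real.exp (-t k ^ 2) with hw
  have hw0 (k : ℕ) : 0 ≤ w k := (Real.exp_pos _).le
  have hw1 (k : ℕ) : w k ≤ 1 := Real.exp_le_one_iff.2 (by nlinarith [sq_nonneg (t k)])
  have hT (m : ℤ) (k : ℕ) : |(Polynomial.Chebyshev.T ℝ m).eval (2 * w k - 1)| ≤ 1 :=
    Polynomial.Chebyshev.abs_eval_T_real_le_one _
      (abs_le.2 ⟨by linarith [hw0 k], by linarith [hw1 k]⟩)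
  have hterm (m : ℤ) (k : ℕ) :
      ‖w k * (Polynomial.Chebyshev.T ℝ m).eval (2 * w k - 1) * c k‖ ≤ w k * |c k| := by
    rw [norm_mul, norm_mul, Real.norm_eq_abs, Real.norm_eq_abs, Real.norm_eq_abs,
      abs_of_nonneg (hw0 k)]
    gcongr
    exact mul_le_of_le_one_right (hw0 k) (hT m k)
  have hprod : Summable (Function.uncurry fun (k : ℕ) (m : ℤ) =>
      a m * (w k * (Polynomial.Chebyshev.T ℝ m).eval (2 * w k - 1) * c k)) := by
    refine Summable.of_norm_bounded (hs.mul_of_nonneg ha0 (fun k => by positivity)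
      (fun m => abs_nonneg _)) fun p => ?_
    rw [Function.uncurry, norm_mul, Real.norm_eq_abs, mul_comm]
    gcongr
    exact hterm _ _
  have hexp : ∑' k, h (t k) * c k =
      ∑' m, a m * ∑' k, w k * (Polynomial.Chebyshev.T ℝ m).eval (2 * w k - 1) * c k := by
    calc _ = ∑' (k : ℕ) (m : ℤ),
          a m * (w k * (Polynomial.Chebyshev.T ℝ m).eval (2 * w k - 1) * c k) := by
          refine tsum_congr fun k => ?_
          rw [← ((hsum (t k) (ht k)).mul_right (c k)).tsum_eq]
          refine tsum_congr fun m => ?_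
          ring
      _ = _ := by
          rw [← hprod.tsum_comm]
          exact tsum_congr fun m => tsum_mul_left
  have hU (m : ℤ) : |∑' k, w k * (Polynomial.Chebyshev.T ℝ m).eval (2 * w k - 1) * c k| ≤
      7 ^ N * M + |(m : ℝ)| ^ j * (D / N ^ j) := by
    have hN' : (0 : ℝ) < N := by exact_mod_cast hN
    -- Degrees below `N` are handled by the moments; for the others `|T_m| ≤ 1` gives the bound `D`,
    -- and `|m| ^ j / N ^ j ≥ 1` is inserted for free.
    rcases lt_or_ge m.natAbs N with hm | hm
    · have := abs_tsum_chebyshev_le hw0 hw1 hs hM m.natAbs 1 le_rfl (by omega)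
      simp only [pow_one, Polynomial.Chebyshev.T_natAbs] at this
      refine this.trans ?_
      have : (7 : ℝ) ^ m.natAbs * M ≤ 7 ^ N * M := by
        gcongr
        norm_num
      have : 0 ≤ |(m : ℝ)| ^ j * (D / N ^ j) := by positivity
      linarith
    · have h1 : |∑' k, w k * (Polynomial.Chebyshev.T ℝ m).eval (2 * w k - 1) * c k| ≤ D :=
        (tsum_of_norm_bounded hs.hasSum (hterm m)).trans hD
      have h2 : D ≤ |(m : ℝ)| ^ j * (D / N ^ j) := by
        have hm' : (N : ℝ) ≤ |(m : ℝ)| := by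
          rw [← Int.cast_abs, Int.abs_eq_natAbs]
          exact_mod_cast hm
        rw [mul_div_assoc', le_div_iff₀ (by positivity), mul_comm]
        gcongr
      have : 0 ≤ 7 ^ N * M := by positivity
      linarith
  rw [hexp]
  have hb : HasSum (fun m : ℤ => |a m| * (7 ^ N * M + |(m : ℝ)| ^ j * (D / N ^ j)))
      (A₀ * (7 ^ N * M) + A₁ * (D / N ^ j)) := by
    refine ((ha0.hasSum.mul_right (7 ^ N * M)).add
      ((ha j).hasSum.mul_right (D / N ^ j))).congr_fun fun m => ?_
    ring
  have h1 := tsum_of_norm_bounded hb fun m => by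
    refine (norm_mul (a m) _).trans_le (mul_le_mul_of_nonneg_left (hU m) (abs_nonneg _))
  rw [Real.norm_eq_abs] at h1
  refine h1.trans ?_
  have h2 : 0 ≤ 7 ^ N * M := by positivity
  have h3 : 0 ≤ D / N ^ j := by positivity
  nlinarith

/-! ### Heat kernel bounds and localization -/

namespace SpectralSystem

variable {X : Type*} [MetricSpace X] [MeasurableSpace X] (Ξ : SpectralSystem X)

theorem lam_nonneg (k : ℕ) : 0 ≤ Ξ.lam k := by
  rw [← Ξ.lam_zero]
  exact Ξ.lam_mono (Nat.zero_le k)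

theorem mem_lowIndices {n : ℝ} {k : ℕ} : k ∈ Ξ.lowIndices n ↔ Ξ.lam k < n := by
  simp [lowIndices]

variable {Ξ} {q : ℝ}

/-- The `i`-th power of `exp (-(λₖ / n) ^ 2)` is the heat multiplier at time `i / n ^ 2`; this time
is at most `1` when `i ≤ n ^ 2`, and at least `n ^ (-2)`, whence the factor `n ^ q`. The absolute
sum is controlled by the two diagonal values through `2 |uv| ≤ u ^ 2 + v ^ 2`. -/
theorem IsDataSpace.exists_gaussian_le (hΞ : Ξ.IsDataSpace q) :
    ∃ κ₁ κ₂ : ℝ, 0 < κ₁ ∧ 0 < κ₂ ∧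
      (∀ (x y : X) (n : ℝ) (i : ℕ), 1 ≤ n → 1 ≤ i → i ≤ n ^ 2 →
        |∑' k, Real.exp (-(Ξ.lam k / n) ^ 2) ^ i * (Ξ.φ k x * Ξ.φ k y)| ≤
          κ₁ * n ^ q * Real.exp (-(κ₂ * ((n * dist x y) ^ 2 / i)))) ∧
      ∀ (x y : X) (n : ℝ), 1 ≤ n →
        (Summable fun k => Real.exp (-(Ξ.lam k / n) ^ 2) * |Ξ.φ k x * Ξ.φ k y|) ∧
        ∑' k, Real.exp (-(Ξ.lam k / n) ^ 2) * |Ξ.φ k x * Ξ.φ k y| ≤ κ₁ * n ^ q := by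
  obtain ⟨κ₁, κ₂, h1, h2, h⟩ := hΞ.gaussian_bound
  have hexp (n : ℝ) (i k : ℕ) : Real.exp (-(Ξ.lam k / n) ^ 2) ^ i =
      Real.exp (-(Ξ.lam k ^ 2 * (i / n ^ 2))) := by
    rw [← Real.exp_nat_mul]
    congr 1
    ring
  have hb (x y : X) (n : ℝ) (i : ℕ) (hn : 1 ≤ n) (hi : 1 ≤ i) (hin : i ≤ n ^ 2) :
      (Summable fun k => Real.exp (-(Ξ.lam k / n) ^ 2) ^ i * (Ξ.φ k x * Ξ.φ k y)) ∧
      |∑' k, Real.exp (-(Ξ.lam k / n) ^ 2) ^ i * (Ξ.φ k x * Ξ.φ k y)| ≤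
        κ₁ * n ^ q * Real.exp (-(κ₂ * ((n * dist x y) ^ 2 / i))) := by
    have hn0 : 0 < n := by linarith
    have hi0 : (1 : ℝ) ≤ i := by exact_mod_cast hi
    have ht : 0 < (i : ℝ) / n ^ 2 := by positivity
    obtain ⟨ha, hab⟩ := h x y (i / n ^ 2) ht (by rwa [div_le_one (by positivity)])
    simp only [hexp, ← mul_assoc]
    refine ⟨ha, hab.trans ?_⟩
    have e1 : dist x y ^ 2 / (i / n ^ 2) = (n * dist x y) ^ 2 / i := by
      field_simp
    rw [e1]
    gcongr
    calc ((i : ℝ) / n ^ 2) ^ (-q / 2) ≤ (1 / n ^ 2) ^ (-q / 2) := by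
          refine Real.rpow_le_rpow_of_nonpos (by positivity) (by gcongr) ?_
          linarith [hΞ.one_le_q]
      _ = n ^ q := by
          rw [one_div, ← Real.rpow_natCast, ← Real.rpow_neg hn0.le, ← Real.rpow_mul hn0.le]
          congr 1
          push_cast
          ring
  have hd (x : X) (n : ℝ) (hn : 1 ≤ n) :
      (Summable fun k => Real.exp (-(Ξ.lam k / n) ^ 2) * (Ξ.φ k x * Ξ.φ k x)) ∧
      ∑' k, Real.exp (-(Ξ.lam k / n) ^ 2) * (Ξ.φ k x * Ξ.φ k x) ≤ κ₁ * n ^ q := by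
    have := hb x x n 1 hn le_rfl (by rw [Nat.cast_one]; exact one_le_pow₀ hn)
    simp only [pow_one, dist_self, mul_zero, ne_eq, OfNat.ofNat_ne_zero, not_false_eq_true,
      zero_pow, zero_div, neg_zero, Real.exp_zero, mul_one] at this
    exact ⟨this.1, (le_abs_self _).trans this.2⟩
  refine ⟨κ₁, κ₂, h1, h2, fun x y n i hn hi hin => (hb x y n i hn hi hin).2, fun x y n hn => ?_⟩
  obtain ⟨hx, hx'⟩ := hd x n hn
  obtain ⟨hy, hy'⟩ := hd y n hn
  have hle (k : ℕ) : Real.exp (-(Ξ.lam k / n) ^ 2) * |Ξ.φ k x * Ξ.φ k y| ≤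
      2⁻¹ * (Real.exp (-(Ξ.lam k / n) ^ 2) * (Ξ.φ k x * Ξ.φ k x) +
        Real.exp (-(Ξ.lam k / n) ^ 2) * (Ξ.φ k y * Ξ.φ k y)) := by
    rw [← mul_add, mul_left_comm]
    gcongr
    rw [abs_mul, ← abs_mul_abs_self (Ξ.φ k x), ← abs_mul_abs_self (Ξ.φ k y)]
    nlinarith [sq_nonneg (|Ξ.φ k x| - |Ξ.φ k y|)]
  have hs := Summable.of_nonneg_of_le (fun k => by positivity) hle ((hx.add hy).mul_left 2⁻¹)
  refine ⟨hs, (hs.tsum_le_tsum hle ((hx.add hy).mul_left 2⁻¹)).trans ?_⟩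
  rw [tsum_mul_left, hx.tsum_add hy]
  linarith

/-- The localization estimate for the kernels `Φₙ`. -/
theorem IsDataSpace.exists_abs_locKernel_le (hΞ : Ξ.IsDataSpace q) {h : ℝ → ℝ}
    (hh : IsLowPassFilter h) {S : ℝ} (hS : 0 < S) :
    ∃ C : ℝ, 0 < C ∧ ∀ n : ℝ, 1 ≤ n → ∀ x y : X,
      |Ξ.locKernel h n x y| ≤ C * (n ^ q / max 1 ((n * dist x y) ^ S) + n ^ (-2 * S)) := by
  obtain ⟨κ₁, κ₂, h1, h2, hM, hD⟩ := hΞ.exists_gaussian_le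
  have hq := hΞ.one_le_q
  -- Large enough for both `r ^ (-j) ≤ r ^ (-S)` and `n ^ (q - 2 * j) ≤ n ^ (-2 * S)`.
  obtain ⟨j, hj⟩ := exists_nat_ge (S + q)
  obtain ⟨A, hA, hmain⟩ := hh.exists_abs_tsum_le j
  obtain ⟨E, hE0, hE⟩ : ∃ E : ℝ, 0 < E ∧ ∀ r : ℝ, 1 ≤ r → Real.exp (-r) ≤ E * r ^ (-S) := by
    obtain ⟨i, hi⟩ := exists_nat_ge S
    refine ⟨i.factorial, by positivity, fun r hr => ?_⟩
    have h3 : r ^ S ≤ r ^ i := by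
      rw [← Real.rpow_natCast]
      exact Real.rpow_le_rpow_of_exponent_le hr hi
    have h4 := Real.pow_div_factorial_le_exp r (by linarith) i
    have h5 : 0 < r ^ S := by positivity
    rw [Real.exp_neg, Real.rpow_neg (by linarith), ← div_eq_mul_inv, inv_le_comm₀ (by positivity)
      (by positivity), inv_div]
    refine le_trans ?_ h4
    gcongr
  -- With `N ≤ ε * r` the Gaussian exponent is at least `3 * r`, while `7 ^ N ≤ exp (2 * r)`; a
  -- factor `exp (-r)` is left.
  set ε := min 1 (κ₂ / 3) with hε
  have hε0 : 0 < ε := by positivity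
  have hε1 : ε ≤ 1 := min_le_left _ _
  have hε2 : 3 ≤ κ₂ / ε := by
    rw [le_div_iff₀ hε0]
    linarith [min_le_right 1 (κ₂ / 3)]
  have hloc (n : ℝ) (x y : X) : Ξ.locKernel h n x y =
      ∑' k, h (Ξ.lam k / n) * (Ξ.φ k x * Ξ.φ k y) := by
    simp only [locKernel, mul_assoc]
  have h7 : Real.log 7 ≤ 2 := by
    rw [Real.log_le_iff_le_exp (by norm_num)]
    have := Real.exp_one_gt_d9
    rw [show (2 : ℝ) = 1 + 1 by norm_num, Real.exp_add]
    nlinarith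
  refine ⟨A * 8 * κ₁ * ε ^ (-S) + A * κ₁ * E + A * κ₁ * 2 ^ j * ε⁻¹ ^ j + A * κ₁ * 2 ^ j,
    by positivity, fun n hn x y => ?_⟩
  have hn0 : 0 < n := by linarith
  have ht (k : ℕ) : 0 ≤ Ξ.lam k / n := div_nonneg (Ξ.lam_nonneg k) hn0.le
  set r := n * dist x y with hr
  have hr0 : 0 ≤ r := by positivity
  obtain ⟨hs, hsD⟩ := hD x y n hn
  rw [hloc]
  rcases lt_or_ge (ε * r) 1 with hsmall | hlarge
  · have hb := hmain (fun k => Ξ.lam k / n) (fun k => Ξ.φ k x * Ξ.φ k y) 1 (κ₁ * n ^ q)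
      (κ₁ * n ^ q) one_pos ht hs hsD (fun i hi hi1 => by
        refine (hM x y n i hn hi ?_).trans ?_
        · have : (i : ℝ) ≤ 1 := by exact_mod_cast hi1
          exact this.trans (one_le_pow₀ hn)
        · refine mul_le_of_le_one_right (by positivity) (Real.exp_le_one_iff.2 ?_)
          have : 0 ≤ κ₂ * ((n * dist x y) ^ 2 / i) := by positivity
          linarith)
    have hmax : max 1 (r ^ S) ≤ ε ^ (-S) := by
      refine max_le ?_ ?_
      · exact Real.one_le_rpow_of_pos_of_le_one_of_nonpos hε0 hε1 (by linarith)
      · rw [Real.rpow_neg hε0.le, ← Real.inv_rpow hε0.le]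
        refine Real.rpow_le_rpow hr0 ?_ hS.le
        rw [← one_div, le_div_iff₀ hε0]
        linarith
    have hquot : n ^ q ≤ ε ^ (-S) * (n ^ q / max 1 (r ^ S)) := by
      rw [mul_div_assoc', le_div_iff₀ (by positivity), mul_comm]
      gcongr
    calc _ ≤ A * (7 ^ 1 * (κ₁ * n ^ q) + κ₁ * n ^ q / (1 : ℕ) ^ j) := hb
      _ = A * 8 * κ₁ * n ^ q := by
        simp
        ring
      _ ≤ A * 8 * κ₁ * (ε ^ (-S) * (n ^ q / max 1 (r ^ S))) := by gcongr
      _ = (A * 8 * κ₁ * ε ^ (-S)) * (n ^ q / max 1 (r ^ S)) := by ring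
      _ ≤ _ := by
        gcongr
        · have : 0 < A * κ₁ * E + A * κ₁ * 2 ^ j * ε⁻¹ ^ j + A * κ₁ * 2 ^ j := by positivity
          linarith
        · have : 0 < n ^ (-2 * S) := by positivity
          linarith
  · have hr1 : 1 ≤ r := hlarge.trans (mul_le_of_le_one_left hr0 hε1)
    -- The cap `n ^ 2` keeps the heat times at most `1`; when it is active, the tail `N ^ (-j)`
    -- produces the term `n ^ (-2 * S)`.
    set m := min (ε * r) (n ^ 2) with hm
    have hm1 : 1 ≤ m := le_min hlarge (one_le_pow₀ hn)
    set N := ⌊m⌋₊ with hN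
    have hN1 : 1 ≤ N := Nat.le_floor (by simpa using hm1)
    have hNm : (N : ℝ) ≤ m := Nat.floor_le (by linarith)
    have hmN : m ≤ 2 * N := by
      have h3 := Nat.lt_floor_add_one m
      have h4 : (1 : ℝ) ≤ N := by exact_mod_cast hN1
      linarith
    have hN0 : (0 : ℝ) < N := by exact_mod_cast hN1
    have hb := hmain (fun k => Ξ.lam k / n) (fun k => Ξ.φ k x * Ξ.φ k y) N
      (κ₁ * n ^ q * Real.exp (-(κ₂ * (r ^ 2 / N)))) (κ₁ * n ^ q) hN1 ht hs hsD
      (fun i hi hiN => by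
        have hiN' : (i : ℝ) ≤ N := by exact_mod_cast hiN
        have hi0 : (0 : ℝ) < i := by exact_mod_cast hi
        refine (hM x y n i hn hi (hiN'.trans (hNm.trans (min_le_right _ _)))).trans ?_
        gcongr)
    have hmax : max 1 (r ^ S) = r ^ S := max_eq_right (Real.one_le_rpow hr1 hS.le)
    have hgauss : 7 ^ N * Real.exp (-(κ₂ * (r ^ 2 / N))) ≤ E * r ^ (-S) := by
      refine le_trans ?_ (hE r hr1)
      rw [← Real.rpow_natCast, Real.rpow_def_of_pos (by norm_num), ← Real.exp_add]
      refine Real.exp_le_exp.2 ?_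
      have h3 : (N : ℝ) ≤ ε * r := hNm.trans (min_le_left _ _)
      have h4 : 3 * r ≤ κ₂ * (r ^ 2 / N) := by
        calc 3 * r ≤ κ₂ / ε * r := by gcongr
          _ = κ₂ * (r ^ 2 / (ε * r)) := by field_simp
          _ ≤ _ := by gcongr
      have h5 : Real.log 7 * N ≤ 2 * r := by
        have : (N : ℝ) ≤ r := h3.trans (mul_le_of_le_one_left hr0 hε1)
        gcongr
      linarith
    have htail : n ^ q * ((N : ℝ) ^ j)⁻¹ ≤
        2 ^ j * ε⁻¹ ^ j * (n ^ q * r ^ (-S)) + 2 ^ j * n ^ (-2 * S) := by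
      have h3 : ((N : ℝ) ^ j)⁻¹ ≤ 2 ^ j * (m ^ j)⁻¹ := by
        rw [← div_eq_mul_inv, inv_le_comm₀ (by positivity) (by positivity), inv_div,
          div_le_iff₀ (by positivity), ← mul_pow, mul_comm]
        gcongr
      have h4 : (m ^ j)⁻¹ ≤ ((ε * r) ^ j)⁻¹ + ((n ^ 2) ^ j)⁻¹ := by
        have p1 : 0 < ((ε * r) ^ j)⁻¹ := by positivity
        have p2 : 0 < ((n ^ 2) ^ j)⁻¹ := by positivity
        rcases min_choice (ε * r) (n ^ 2) with h | h <;> rw [hm, h] <;> linarith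
      have h5 : ((ε * r) ^ j)⁻¹ ≤ ε⁻¹ ^ j * r ^ (-S) := by
        rw [mul_pow, mul_inv, inv_pow, Real.rpow_neg hr0, ← Real.rpow_natCast r]
        gcongr
        linarith
      have h6 : n ^ q * ((n ^ 2) ^ j)⁻¹ ≤ n ^ (-2 * S) := by
        rw [← pow_mul, ← Real.rpow_natCast, ← Real.rpow_neg hn0.le, ← Real.rpow_add hn0]
        refine Real.rpow_le_rpow_of_exponent_le hn ?_
        push_cast
        linarith
      calc _ ≤ n ^ q * (2 ^ j * (ε⁻¹ ^ j * r ^ (-S) + ((n ^ 2) ^ j)⁻¹)) := by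
            gcongr
            refine h3.trans ?_
            gcongr
            linarith
        _ = 2 ^ j * ε⁻¹ ^ j * (n ^ q * r ^ (-S)) + 2 ^ j * (n ^ q * ((n ^ 2) ^ j)⁻¹) := by ring
        _ ≤ _ := by gcongr
    rw [hmax, div_eq_mul_inv, ← Real.rpow_neg hr0]
    set u := n ^ q * r ^ (-S) with hu
    set v := n ^ (-2 * S) with hv
    have hu0 : 0 < u := by positivity
    have hv0 : 0 < v := by positivity
    calc _ ≤ A * (7 ^ N * (κ₁ * n ^ q * Real.exp (-(κ₂ * (r ^ 2 / N)))) +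
          κ₁ * n ^ q / N ^ j) := hb
      _ = A * κ₁ * (n ^ q * (7 ^ N * Real.exp (-(κ₂ * (r ^ 2 / N)))) +
          n ^ q * ((N : ℝ) ^ j)⁻¹) := by ring
      _ ≤ A * κ₁ * (n ^ q * (E * r ^ (-S)) + (2 ^ j * ε⁻¹ ^ j * u + 2 ^ j * v)) := by
        gcongr
      _ = (A * κ₁ * E + A * κ₁ * 2 ^ j * ε⁻¹ ^ j) * u + A * κ₁ * 2 ^ j * v := by
        rw [hu]
        ring
      _ ≤ _ := by
        rw [mul_add]
        have p1 : 0 < A * 8 * κ₁ * ε ^ (-S) := by positivity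
        have p2 : 0 < A * κ₁ * E := by positivity
        have p3 : 0 < A * κ₁ * 2 ^ j * ε⁻¹ ^ j := by positivity
        have p4 : 0 < A * κ₁ * 2 ^ j := by positivity
        exact add_le_add (mul_le_mul_of_nonneg_right (by linarith) hu0.le)
          (mul_le_mul_of_nonneg_right (by linarith) hv0.le)

end SpectralSystem

/-! ### Mask decay and spectral tails -/

/-- Fast decrease gives the bound only for large `t`; on the remaining bounded range the ratio is at
most `1` by monotonicity and `1 ≤ B`. -/
theorem IsSmoothMask.exists_le_rpow {b : ℝ → ℝ} {B : ℝ} (hb : IsSmoothMask b B) {S : ℝ}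
    (hS : 0 < S) : ∃ C : ℝ, 0 < C ∧ ∀ t, 1 ≤ t → b (B * t) ≤ C * t ^ (-S) * b t := by
  obtain ⟨T, hT⟩ := eventually_atTop.1
    ((hb.fastDecreasing S hS).eventually (gt_mem_nhds (zero_lt_one' ℝ)))
  refine ⟨max 1 T ^ S, by positivity, fun t ht => ?_⟩
  have hpos := hb.pos t (by linarith)
  have ht0 : 0 < t := by linarith
  have hle1 : 1 ≤ max 1 T ^ S := Real.one_le_rpow (le_max_left _ _) hS.le
  have hkey : t ^ S * (b (B * t) / b t) ≤ max 1 T ^ S := by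
    rcases le_total T t with h | h
    · exact (hT t h).le.trans hle1
    · have h1 : b (B * t) / b t ≤ 1 := by
        rw [div_le_one hpos]
        have h2 : t ≤ B * t := le_mul_of_one_le_left ht0.le hb.one_le
        exact hb.antitoneOn ht0.le (ht0.le.trans h2) h2
      calc _ ≤ t ^ S * 1 := by gcongr
        _ ≤ _ := by
          rw [mul_one]
          gcongr
          exact h.trans (le_max_right _ _)
  rw [mul_div_assoc', div_le_iff₀ hpos] at hkey
  rw [Real.rpow_neg ht0.le, mul_right_comm, ← div_eq_mul_inv, le_div_iff₀ (by positivity), mul_comm]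
  exact hkey

namespace SpectralSystem

variable {X : Type*} [MetricSpace X] [MeasurableSpace X] {Ξ : SpectralSystem X} {q : ℝ}

/-- For `λₖ < n` the weight `exp (-(λₖ / n) ^ 2)` is at least `exp (-1)`, so the heat kernel on the
diagonal dominates. -/
theorem IsDataSpace.exists_christoffel_le (hΞ : Ξ.IsDataSpace q) :
    ∃ C : ℝ, 0 < C ∧ ∀ n : ℝ, 1 ≤ n → ∀ x : X, Ξ.christoffel n x ≤ C * n ^ q := by
  obtain ⟨κ₁, κ₂, h1, h2, -, hD⟩ := hΞ.exists_gaussian_le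
  refine ⟨Real.exp 1 * κ₁, by positivity, fun n hn x => ?_⟩
  obtain ⟨hs, hsD⟩ := hD x x n hn
  have hn0 : 0 < n := by linarith
  calc Ξ.christoffel n x
      ≤ ∑ k ∈ Ξ.lowIndices n,
        Real.exp 1 * (Real.exp (-(Ξ.lam k / n) ^ 2) * |Ξ.φ k x * Ξ.φ k x|) := by
        refine Finset.sum_le_sum fun k hk => ?_
        rw [mem_lowIndices] at hk
        have h3 : Ξ.lam k / n ≤ 1 := by
          rw [div_le_one hn0]
          exact hk.le
        have h4 : (Ξ.lam k / n) ^ 2 ≤ 1 := pow_le_one₀ (div_nonneg (Ξ.lam_nonneg k) hn0.le) h3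
        rw [← mul_assoc, ← Real.exp_add, abs_mul_self, ← sq]
        exact le_mul_of_one_le_left (sq_nonneg _) (Real.one_le_exp (by linarith))
    _ ≤ Real.exp 1 * (κ₁ * n ^ q) := by
        rw [← Finset.mul_sum]
        gcongr
        exact (hs.sum_le_tsum _ (fun k _ => by positivity)).trans hsD
    _ = _ := by ring

/-- Group the indices by `j = ⌈λₖ⌉`: each group has Christoffel mass `O(j ^ q)`, and the weight
leaves the summable `j ^ (-2)`. -/
theorem IsDataSpace.exists_sum_rpow_mul_sq_le (hΞ : Ξ.IsDataSpace q) :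
    ∃ C : ℝ, 0 < C ∧ ∀ (x : X) (s : Finset ℕ), (∀ k ∈ s, 1 ≤ Ξ.lam k) →
      ∑ k ∈ s, Ξ.lam k ^ (-(q + 2)) * Ξ.φ k x ^ 2 ≤ C := by
  obtain ⟨C, hC, hK⟩ := hΞ.exists_christoffel_le
  have hq := hΞ.one_le_q
  have hsum : Summable fun j : ℕ => 1 / (j : ℝ) ^ 2 :=
    Real.summable_one_div_nat_pow.2 one_lt_two
  set Z := ∑' j : ℕ, 1 / (j : ℝ) ^ 2 with hZ
  have hZ0 : 0 ≤ Z := tsum_nonneg fun j => by positivity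
  refine ⟨2 ^ (q + 2) * (C * 2 ^ q) * Z + 1, by positivity, fun x s hs => ?_⟩
  have hfib (j : ℕ) (hj : j ∈ s.image fun k => ⌈Ξ.lam k⌉₊) :
      ∑ k ∈ s with ⌈Ξ.lam k⌉₊ = j, Ξ.lam k ^ (-(q + 2)) * Ξ.φ k x ^ 2 ≤
        2 ^ (q + 2) * (C * 2 ^ q) * (1 / (j : ℝ) ^ 2) := by
    obtain ⟨k₀, hk₀, rfl⟩ := Finset.mem_image.1 hj
    set j := ⌈Ξ.lam k₀⌉₊
    have hj1 : (1 : ℝ) ≤ j := (hs k₀ hk₀).trans (Nat.le_ceil _)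
    have hj0 : (0 : ℝ) < j := by linarith
    calc _ ≤ ∑ k ∈ s with ⌈Ξ.lam k⌉₊ = j, ((j : ℝ) / 2) ^ (-(q + 2)) * Ξ.φ k x ^ 2 := by
          refine Finset.sum_le_sum fun k hk => ?_
          obtain ⟨hks, hkj⟩ := Finset.mem_filter.1 hk
          have h1 := hs k hks
          have h2 : (j : ℝ) < Ξ.lam k + 1 := by
            rw [← hkj]
            exact Nat.ceil_lt_add_one (by linarith)
          gcongr ?_ * _
          exact Real.rpow_le_rpow_of_nonpos (by positivity) (by linarith) (by linarith)
      _ ≤ ((j : ℝ) / 2) ^ (-(q + 2)) * Ξ.christoffel (j + 1) x := by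
          rw [← Finset.mul_sum]
          gcongr
          refine Finset.sum_le_sum_of_subset_of_nonneg (fun k hk => ?_) fun _ _ _ => sq_nonneg _
          obtain ⟨hks, hkj⟩ := Finset.mem_filter.1 hk
          rw [mem_lowIndices, ← hkj]
          linarith [Nat.le_ceil (Ξ.lam k)]
      _ ≤ ((j : ℝ) / 2) ^ (-(q + 2)) * (C * (2 * j) ^ q) := by
          gcongr
          refine (hK _ (by linarith) x).trans ?_
          gcongr
          linarith
      _ = _ := by
          have h3 : (j : ℝ) ^ (q + 2) = j ^ q * j ^ 2 := by
            rw [Real.rpow_add hj0, Real.rpow_two]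
          rw [Real.rpow_neg (by positivity), Real.div_rpow hj0.le two_pos.le, inv_div,
            Real.mul_rpow two_pos.le hj0.le, h3]
          field_simp
  rw [← Finset.sum_fiberwise_of_maps_to (fun k hk => Finset.mem_image_of_mem
    (fun k => ⌈Ξ.lam k⌉₊) hk)]
  refine (Finset.sum_le_sum hfib).trans ?_
  rw [← Finset.mul_sum]
  have : ∑ j ∈ s.image fun k => ⌈Ξ.lam k⌉₊, 1 / (j : ℝ) ^ 2 ≤ Z :=
    hsum.sum_le_tsum _ fun j _ => by positivity
  have : 2 ^ (q + 2) * (C * 2 ^ q) * ∑ j ∈ s.image fun k => ⌈Ξ.lam k⌉₊, 1 / (j : ℝ) ^ 2 ≤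
      2 ^ (q + 2) * (C * 2 ^ q) * Z := by gcongr
  linarith

/-- The part of the expansion of `G(x, z) W(z)` with `λₖ ≥ B n` is negligible relative to `b n`. -/
theorem IsDataSpace.exists_abs_tail_le (hΞ : Ξ.IsDataSpace q) {G : X → X → ℝ} {W : X → ℝ}
    {b : ℝ → ℝ} {B : ℝ} (hG : Ξ.IsSmoothKernel G W b B) {S : ℝ} (hS : 0 < S) :
    ∃ C : ℝ, 0 < C ∧ ∀ n : ℝ, 1 ≤ n → ∀ x z : X,
      |G x z * W z - ∑ k ∈ Ξ.lowIndices (B * n), b (Ξ.lam k) * Ξ.φ k x * Ξ.φ k z| ≤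
        C * n ^ (-S) * b n := by
  have hq := hΞ.one_le_q
  -- The power `S` is kept for `n`; the power `q + 2` pays for the summation over `k`.
  obtain ⟨C₁, hC₁, hb⟩ := hG.mask.exists_le_rpow (S := S + (q + 2)) (by linarith)
  obtain ⟨C₂, hC₂, hφ⟩ := hΞ.exists_sum_rpow_mul_sq_le
  have hB := hG.mask.one_le
  have hB0 : 0 < B := by linarith
  refine ⟨C₁ * B ^ (S + (q + 2)) * C₂, by positivity, fun n hn x z => ?_⟩
  have hn0 : 0 < n := by linarith
  have hbn := hG.mask.pos n hn0.le
  have hnB : n ≤ B * n := le_mul_of_one_le_left hn0.le hB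
  have hterm (k : ℕ) (hk : B * n ≤ Ξ.lam k) :
      b (Ξ.lam k) ≤ C₁ * B ^ (S + (q + 2)) * n ^ (-S) * b n * Ξ.lam k ^ (-(q + 2)) := by
    have hl : 0 < Ξ.lam k := by nlinarith
    have h1 : n ≤ Ξ.lam k / B := by
      rw [le_div_iff₀ hB0]
      linarith
    have h2 := hb (Ξ.lam k / B) (hn.trans h1)
    rw [mul_div_cancel₀ _ hB0.ne'] at h2
    have h3 : b (Ξ.lam k / B) ≤ b n := hG.mask.antitoneOn hn0.le (hn0.le.trans h1) h1
    calc _ ≤ C₁ * (Ξ.lam k / B) ^ (-(S + (q + 2))) * b n := by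
          refine h2.trans ?_
          gcongr
      _ = C₁ * B ^ (S + (q + 2)) * Ξ.lam k ^ (-S) * b n * Ξ.lam k ^ (-(q + 2)) := by
          rw [Real.div_rpow hl.le hB0.le, Real.rpow_neg hB0.le, div_inv_eq_mul, neg_add,
            Real.rpow_add hl]
          ring
      _ ≤ _ := by
          gcongr ?_ * _ * _
          gcongr ?_ * ?_
          exact Real.rpow_le_rpow_of_nonpos hn0 (hnB.trans hk) (by linarith)
  have hlim : Tendsto (fun s : Finset ℕ => |∑ k ∈ s, b (Ξ.lam k) * Ξ.φ k x * Ξ.φ k z -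
      ∑ k ∈ Ξ.lowIndices (B * n), b (Ξ.lam k) * Ξ.φ k x * Ξ.φ k z|) atTop
      (𝓝 |W z * G x z - ∑ k ∈ Ξ.lowIndices (B * n), b (Ξ.lam k) * Ξ.φ k x * Ξ.φ k z|) :=
    (Tendsto.sub_const (hG.expansion x z) _).abs
  rw [mul_comm (G x z)]
  refine le_of_tendsto hlim ?_
  -- The bound is uniform over finite index sets containing the low ones, so it passes to the
  -- unconditional sum.
  filter_upwards [eventually_ge_atTop (Ξ.lowIndices (B * n))] with s hs
  rw [← Finset.sum_sdiff_eq_sub hs]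
  set A := C₁ * B ^ (S + (q + 2)) * n ^ (-S) * b n with hA
  have hA0 : 0 ≤ A := by positivity
  have hlow (k : ℕ) (hk : k ∈ s \ Ξ.lowIndices (B * n)) : B * n ≤ Ξ.lam k := by
    have := (Finset.mem_sdiff.1 hk).2
    rwa [mem_lowIndices, not_lt] at this
  have hone (k : ℕ) (hk : k ∈ s \ Ξ.lowIndices (B * n)) : 1 ≤ Ξ.lam k :=
    hn.trans (hnB.trans (hlow k hk))
  calc _ ≤ ∑ k ∈ s \ Ξ.lowIndices (B * n), |b (Ξ.lam k) * Ξ.φ k x * Ξ.φ k z| :=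
        Finset.abs_sum_le_sum_abs _ _
    _ ≤ ∑ k ∈ s \ Ξ.lowIndices (B * n), A * (2⁻¹ *
        (Ξ.lam k ^ (-(q + 2)) * Ξ.φ k x ^ 2 + Ξ.lam k ^ (-(q + 2)) * Ξ.φ k z ^ 2)) := by
        refine Finset.sum_le_sum fun k hk => ?_
        have hp := hG.mask.pos (Ξ.lam k) (Ξ.lam_nonneg k)
        have hl : 0 < Ξ.lam k ^ (-(q + 2)) := Real.rpow_pos_of_pos (by linarith [hone k hk]) _
        rw [mul_assoc, abs_mul, abs_of_pos hp, abs_mul]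
        have h4 : |Ξ.φ k x| * |Ξ.φ k z| ≤ 2⁻¹ * (Ξ.φ k x ^ 2 + Ξ.φ k z ^ 2) := by
          rw [← sq_abs (Ξ.φ k x), ← sq_abs (Ξ.φ k z)]
          nlinarith [sq_nonneg (|Ξ.φ k x| - |Ξ.φ k z|)]
        calc _ ≤ (A * Ξ.lam k ^ (-(q + 2))) * (2⁻¹ * (Ξ.φ k x ^ 2 + Ξ.φ k z ^ 2)) :=
              mul_le_mul (hterm k (hlow k hk)) h4 (by positivity) (by positivity)
          _ = _ := by ring
    _ ≤ A * (2⁻¹ * (C₂ + C₂)) := by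
        rw [← Finset.mul_sum, ← Finset.mul_sum, Finset.sum_add_distrib]
        gcongr
        · exact hφ x _ hone
        · exact hφ z _ hone
    _ = _ := by
        rw [hA]
        ring

end SpectralSystem

/-! ### Interpolation between `L¹` and `L^∞` -/

/-- A function with bounds on its supremum and its `L¹` norm satisfies the same bound in `Lᵖ`. -/
theorem eLpNorm_le_of_enorm_le_of_lintegral_le {α : Type*} [MeasurableSpace α] {μ : Measure α}
    {f : α → ℝ} {M : ℝ≥0∞} (hM : M ≠ ⊤) (h1 : ∀ x, ‖f x‖ₑ ≤ M) (h2 : ∫⁻ x, ‖f x‖ₑ ∂μ ≤ M)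
    {p : ℝ≥0∞} (hp : 1 ≤ p) : eLpNorm f p μ ≤ M := by
  rcases eq_or_ne p ⊤ with rfl | hp'
  · rw [eLpNorm_exponent_top]
    exact eLpNormEssSup_le_of_ae_enorm_bound (ae_of_all _ h1)
  have hp0 : p ≠ 0 := (zero_lt_one.trans_le hp).ne'
  have hr : 1 ≤ p.toReal := by
    rw [← ENNReal.toReal_one]
    exact ENNReal.toReal_mono hp' hp
  rw [eLpNorm_eq_lintegral_rpow_enorm_toReal hp0 hp']
  -- Pointwise `|f| ^ p ≤ M ^ (p - 1) * |f|`.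
  have h3 : ∫⁻ x, ‖f x‖ₑ ^ p.toReal ∂μ ≤ M ^ p.toReal := by
    calc _ ≤ ∫⁻ x, M ^ (p.toReal - 1) * ‖f x‖ₑ ∂μ := by
          refine lintegral_mono fun x => ?_
          calc ‖f x‖ₑ ^ p.toReal = ‖f x‖ₑ ^ (p.toReal - 1) * ‖f x‖ₑ ^ (1 : ℝ) := by
                rw [← ENNReal.rpow_add_of_nonneg _ _ (by linarith) zero_le_one, sub_add_cancel]
            _ ≤ _ := by
                rw [ENNReal.rpow_one]
                exact mul_le_mul_left (ENNReal.rpow_le_rpow (h1 x) (by linarith)) _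
      _ = M ^ (p.toReal - 1) * ∫⁻ x, ‖f x‖ₑ ∂μ :=
          lintegral_const_mul' _ _ (ENNReal.rpow_ne_top_of_nonneg (by linarith) hM)
      _ ≤ M ^ (p.toReal - 1) * M ^ (1 : ℝ) := by
          rw [ENNReal.rpow_one]
          gcongr
      _ = _ := by
          rw [← ENNReal.rpow_add_of_nonneg _ _ (by linarith) zero_le_one, sub_add_cancel]
  calc _ ≤ (M ^ p.toReal) ^ (1 / p.toReal) := by gcongr
    _ = M := by
        rw [← ENNReal.rpow_mul, mul_one_div_cancel (by linarith), ENNReal.rpow_one]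

/-! ### Eignets as approximations of the localized kernels -/

namespace SpectralSystem

variable {X : Type*} [MetricSpace X] [MeasurableSpace X] {Ξ : SpectralSystem X} {q : ℝ}

theorem locKernel_eq_sum {h : ℝ → ℝ} (hh : IsLowPassFilter h) {n : ℝ} (hn : 0 < n) (x y : X) :
    Ξ.locKernel h n x y = ∑ k ∈ Ξ.lowIndices n, h (Ξ.lam k / n) * Ξ.φ k x * Ξ.φ k y := by
  refine tsum_eq_sum fun k hk => ?_
  rw [mem_lowIndices, not_lt] at hk
  rw [hh.eq_zero _ ((one_le_div hn).2 hk)]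
  ring

theorem inverseKernel_eq_sum {h : ℝ → ℝ} (hh : IsLowPassFilter h) (b : ℝ → ℝ) {n : ℝ} (hn : 0 < n)
    (x y : X) : Ξ.inverseKernel h b n x y =
      ∑ k ∈ Ξ.lowIndices n, h (Ξ.lam k / n) * (b (Ξ.lam k))⁻¹ * Ξ.φ k x * Ξ.φ k y := by
  refine tsum_eq_sum fun k hk => ?_
  rw [mem_lowIndices, not_lt] at hk
  rw [hh.eq_zero _ ((one_le_div hn).2 hk)]
  ring

/-- Monotonicity of `b` gives `(b λₖ)⁻¹ ≤ (b n)⁻¹` for `λₖ < n`, and Cauchy–Schwarz does the rest.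
The factor `(b n)⁻¹` is what the tail estimate has to cancel. -/
theorem abs_inverseKernel_le {h b : ℝ → ℝ} (hh : IsLowPassFilter h) {B : ℝ}
    (hb : IsSmoothMask b B) {n : ℝ} (hn : 0 < n) (x y : X) :
    |Ξ.inverseKernel h b n x y| ≤
      (b n)⁻¹ * (√(Ξ.christoffel n x) * √(Ξ.christoffel n y)) := by
  have hbn := hb.pos n hn.le
  rw [inverseKernel_eq_sum hh b hn]
  calc _ ≤ ∑ k ∈ Ξ.lowIndices n, |h (Ξ.lam k / n) * (b (Ξ.lam k))⁻¹ * Ξ.φ k x * Ξ.φ k y| :=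
        Finset.abs_sum_le_sum_abs _ _
    _ ≤ ∑ k ∈ Ξ.lowIndices n, (b n)⁻¹ * (|Ξ.φ k x| * |Ξ.φ k y|) := by
        refine Finset.sum_le_sum fun k hk => ?_
        rw [mem_lowIndices] at hk
        have hl := Ξ.lam_nonneg k
        have hle : b n ≤ b (Ξ.lam k) := hb.antitoneOn hl hn.le hk.le
        have hpos := hb.pos _ hl
        rw [abs_mul, abs_mul, abs_mul, abs_of_nonneg (hh.nonneg _), abs_of_pos (inv_pos.2 hpos),
          mul_assoc]
        gcongr
        calc _ ≤ 1 * (b n)⁻¹ := by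
              gcongr
              exact hh.le_one _
          _ = _ := one_mul _
    _ ≤ _ := by
        rw [← Finset.mul_sum]
        gcongr
        have := Real.sum_mul_le_sqrt_mul_sqrt (Ξ.lowIndices n) (fun k => |Ξ.φ k x|)
          (fun k => |Ξ.φ k y|)
        simpa only [sq_abs, christoffel] using this

theorem IsAdmissibleProductQuadrature.integral_mul {ν : ℝ → SignedMeasure X}
    (hν : Ξ.IsAdmissibleProductQuadrature ν) {n : ℝ} (hn : 1 ≤ n) {j k : ℕ}
    (hj : Ξ.lam j < n) (hk : Ξ.lam k < n) :
    ∫ᵛ x, Ξ.φ j x * Ξ.φ k x ∂•(ν n) = if j = k then 1 else 0 := by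
  rw [hν.quadrature n hn _ (Submodule.subset_span ⟨j, hj, rfl⟩) _
    (Submodule.subset_span ⟨k, hk, rfl⟩)]
  exact Ξ.φ_orthonormal j k

section Borel

variable [BorelSpace X]

theorem integrable_mul_of_isFiniteMeasure (Ξ : SpectralSystem X) (m : Measure X) [IsFiniteMeasure m]
    (j k : ℕ) : Integrable (fun z => Ξ.φ j z * Ξ.φ k z) m := by
  refine Integrable.of_bound (C := ‖Ξ.φ j‖ * ‖Ξ.φ k‖)
    ((Ξ.φ j).continuous.mul (Ξ.φ k).continuous).measurable.aestronglyMeasurable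
    (ae_of_all _ fun z => ?_)
  rw [norm_mul]
  gcongr
  · exact (Ξ.φ j).toBCF.norm_coe_le_norm z
  · exact (Ξ.φ k).toBCF.norm_coe_le_norm z

/-- Measurability in `z` comes from the expansion, as a pointwise limit of continuous partial sums;
none is assumed of `G` itself. -/
theorem IsSmoothKernel.measurable {G : X → X → ℝ} {W : X → ℝ} {b : ℝ → ℝ} {B : ℝ}
    (hG : Ξ.IsSmoothKernel G W b B) (x : X) : Measurable fun z => G x z * W z := by
  refine measurable_of_tendsto_metrizable
    (f := fun N z => ∑ k ∈ Finset.range N, b (Ξ.lam k) * Ξ.φ k x * Ξ.φ k z) (fun N => ?_) ?_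
  · exact Finset.measurable_fun_sum _ fun k _ => (Ξ.φ k).continuous.measurable.const_mul _
  · rw [tendsto_pi_nhds]
    intro z
    rw [mul_comm]
    exact (hG.expansion x z).tendsto_sum_nat

theorem measurable_inverseKernel {h : ℝ → ℝ} (hh : IsLowPassFilter h) (b : ℝ → ℝ) {n : ℝ}
    (hn : 0 < n) (y : X) : Measurable fun z => Ξ.inverseKernel h b n z y := by
  simp only [inverseKernel_eq_sum hh b hn]
  exact Finset.measurable_fun_sum _ fun k _ =>
    ((Ξ.φ k).continuous.measurable.const_mul _).mul_const _

/-- The pre-fabricated eignets are well defined, and they approximate the kernels `Φₙ`. -/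
theorem IsDataSpace.exists_abs_eignetKernel_sub_le (hΞ : Ξ.IsDataSpace q) {h : ℝ → ℝ}
    (hh : IsLowPassFilter h) {G : X → X → ℝ} {W : X → ℝ} {b : ℝ → ℝ} {B : ℝ}
    (hG : Ξ.IsSmoothKernel G W b B) {ν : ℝ → SignedMeasure X}
    (hν : Ξ.IsAdmissibleProductQuadrature ν) {S : ℝ} (hS : 0 < S) :
    ∃ C : ℝ, 0 < C ∧ ∀ n : ℝ, 1 ≤ n → ∀ x y : X,
      Integrable (fun z => G x z * W z * Ξ.inverseKernel h b n z y) (ν (B * n)).variation ∧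
      |Ξ.eignetKernel h b G W n (ν (B * n)) x y - Ξ.locKernel h n x y| ≤
        C * n ^ (-S) * √(Ξ.christoffel n y) := by
  obtain ⟨c₁, c₂, hc₁, hc₂, hgrow⟩ := hν.growth
  obtain ⟨C₁, hC₁, hchr⟩ := hΞ.exists_christoffel_le
  have hq := hΞ.one_le_q
  -- The extra `c₂` absorbs the total variation of the quadrature measure, and `q` the Christoffel
  -- factor in `z`.
  obtain ⟨C₂, hC₂, htail⟩ := hΞ.exists_abs_tail_le hG (S := S + c₂ + q) (by linarith)
  have hB := hG.mask.one_le
  have hB0 : 0 < B := by linarith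
  refine ⟨C₂ * √C₁ * (c₁ * B ^ c₂), by positivity, fun n hn x y => ?_⟩
  have hn0 : 0 < n := by linarith
  have hbn := hG.mask.pos n hn0.le
  have hnB : n ≤ B * n := le_mul_of_one_le_left hn0.le hB
  have hBn : 1 ≤ B * n := hn.trans hnB
  set V := (ν (B * n)).variation with hV
  have hVle : V Set.univ ≤ ENNReal.ofReal (c₁ * (B * n) ^ c₂) := hgrow _ hBn
  have : IsFiniteMeasure V := ⟨hVle.trans_lt ENNReal.ofReal_lt_top⟩
  have hVreal : V.real Set.univ ≤ c₁ * (B * n) ^ c₂ :=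
    ENNReal.toReal_le_of_le_ofReal (by positivity) hVle
  set L : X → ℝ := fun z => ∑ k ∈ Ξ.lowIndices (B * n), b (Ξ.lam k) * Ξ.φ k x * Ξ.φ k z with hL
  set D : X → ℝ := fun z => Ξ.inverseKernel h b n z y with hD
  have hLm : Measurable L := Finset.measurable_fun_sum _ fun k _ =>
    (Ξ.φ k).continuous.measurable.const_mul _
  have hDm : Measurable D := measurable_inverseKernel hh b hn0 y
  have hLD (z : X) : L z * D z = ∑ j ∈ Ξ.lowIndices (B * n), ∑ k ∈ Ξ.lowIndices n,
      (b (Ξ.lam j) * Ξ.φ j x * (h (Ξ.lam k / n) * (b (Ξ.lam k))⁻¹ * Ξ.φ k y)) •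
        (Ξ.φ j z * Ξ.φ k z) := by
    simp only [hL, hD, inverseKernel_eq_sum hh b hn0, Finset.sum_mul_sum]
    refine Finset.sum_congr rfl fun j _ => Finset.sum_congr rfl fun k _ => ?_
    rw [smul_eq_mul]
    ring
  have hint (j k : ℕ) (c : ℝ) : Integrable (fun z => c • (Ξ.φ j z * Ξ.φ k z)) V :=
    (Ξ.integrable_mul_of_isFiniteMeasure V j k).smul c
  have hLDint : Integrable (fun z => L z * D z) V := by
    simp only [hLD]
    exact integrable_finsetSum _ fun j _ => integrable_finsetSum _ fun k _ => hint j k _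
  -- Both factors lie in the space of order `B * n`, so quadrature is exact; only `j = k` survives,
  -- and there `b` cancels its inverse.
  have hLDval : ∫ᵛ z, L z * D z ∂•(ν (B * n)) = Ξ.locKernel h n x y := by
    simp only [hLD]
    rw [VectorMeasure.integral_finsetSum _ fun j _ =>
      integrable_finsetSum _ fun k _ => hint j k _]
    rw [Finset.sum_congr rfl fun j _ => VectorMeasure.integral_finsetSum _ fun k _ => hint j k _]
    rw [Finset.sum_comm, locKernel_eq_sum hh hn0]
    refine Finset.sum_congr rfl fun k hk => ?_
    have hkn : Ξ.lam k < n := Ξ.mem_lowIndices.1 hk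
    have hkB : k ∈ Ξ.lowIndices (B * n) := Ξ.mem_lowIndices.2 (hkn.trans_le hnB)
    rw [Finset.sum_eq_single_of_mem k hkB]
    · rw [VectorMeasure.integral_fun_smul, hν.integral_mul hBn (hkn.trans_le hnB)
        (hkn.trans_le hnB), if_pos rfl, smul_eq_mul, mul_one]
      have := (hG.mask.pos _ (Ξ.lam_nonneg k)).ne'
      field_simp
    · intro j hj hjk
      rw [VectorMeasure.integral_fun_smul, hν.integral_mul hBn (Ξ.mem_lowIndices.1 hj)
        (hkn.trans_le hnB), if_neg hjk, smul_zero]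
  have hRD (z : X) : ‖(G x z * W z - L z) * D z‖ ≤
      C₂ * n ^ (-(S + c₂ + q)) * (√(C₁ * n ^ q) * √(Ξ.christoffel n y)) := by
    rw [norm_mul]
    calc _ ≤ C₂ * n ^ (-(S + c₂ + q)) * b n *
          ((b n)⁻¹ * (√(C₁ * n ^ q) * √(Ξ.christoffel n y))) := by
          refine mul_le_mul (htail n hn x z) ((abs_inverseKernel_le hh hG.mask hn0 z y).trans ?_)
            (norm_nonneg _) (by positivity)
          gcongr
          exact hchr n hn z
      _ = _ := by field_simp
  have hRDint : Integrable (fun z => (G x z * W z - L z) * D z) V :=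
    Integrable.of_bound (((hG.measurable x).sub hLm).mul hDm).aestronglyMeasurable
      _ (ae_of_all _ hRD)
  have hsplit : (fun z => G x z * W z * D z) =
      fun z => L z * D z + (G x z * W z - L z) * D z := by
    ext z
    ring
  refine ⟨hsplit ▸ hLDint.add hRDint, ?_⟩
  have hval : Ξ.eignetKernel h b G W n (ν (B * n)) x y - Ξ.locKernel h n x y =
      ∫ᵛ z, (G x z * W z - L z) * D z ∂•(ν (B * n)) := by
    rw [eignetKernel, ← hLDval, hsplit, VectorMeasure.integral_fun_add hLDint hRDint]
    ring
  rw [hval]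
  have hnorm := VectorMeasure.norm_integral_le_of_norm_le_const (μ := ν (B * n))
    (B := ContinuousLinearMap.lsmul ℝ ℝ) (ae_of_all V hRD)
  rw [Real.norm_eq_abs] at hnorm
  refine hnorm.trans ?_
  have hop : ‖(ContinuousLinearMap.lsmul ℝ ℝ : ℝ →L[ℝ] ℝ →L[ℝ] ℝ)‖ ≤ 1 :=
    ContinuousLinearMap.opNorm_lsmul_le
  have hsq : √(C₁ * n ^ q) ≤ √C₁ * n ^ q := by
    rw [Real.sqrt_mul hC₁.le]
    gcongr
    have h1 : 1 ≤ n ^ q := Real.one_le_rpow hn (by linarith)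
    exact Real.sqrt_le_iff.2 ⟨by positivity, by nlinarith⟩
  calc _ ≤ C₂ * n ^ (-(S + c₂ + q)) * (√C₁ * n ^ q * √(Ξ.christoffel n y)) * 1 *
        (c₁ * (B * n) ^ c₂) := by gcongr
    _ = C₂ * √C₁ * (c₁ * B ^ c₂) * (n ^ (-(S + c₂ + q)) * n ^ q * n ^ c₂) *
        √(Ξ.christoffel n y) := by
        rw [Real.mul_rpow hB0.le hn0.le]
        ring
    _ = _ := by
        rw [← Real.rpow_add hn0, ← Real.rpow_add hn0]
        congr 3
        ring

end Borel

end SpectralSystem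

/-! ### Uniform `Lᵖ` and pointwise estimates -/

namespace SpectralSystem

variable {X : Type*} [MetricSpace X] [MeasurableSpace X] {Ξ : SpectralSystem X} {q : ℝ}

/-- The set lies in a ball about any of its points; the `+ 1` keeps the radius positive when the
diameter is zero. -/
theorem IsDataSpace.exists_measure_le_of_isCompact (hΞ : Ξ.IsDataSpace q) :
    ∃ κ : ℝ, 0 < κ ∧ ∀ K : Set X, IsCompact K →
      Ξ.μ K ≤ ENNReal.ofReal (κ * (Metric.diam K + 1) ^ q) := by
  obtain ⟨κ, hκ, h⟩ := hΞ.ball_measure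
  refine ⟨κ, hκ, fun K hK => ?_⟩
  rcases K.eq_empty_or_nonempty with rfl | ⟨x, hx⟩
  · simp
  have hd : 0 ≤ Metric.diam K := Metric.diam_nonneg
  refine (measure_mono fun y hy => ?_).trans (h x (Metric.diam K + 1) (by linarith)).2
  exact (Metric.dist_le_diam_of_mem hK.isBounded hy hx).trans (by linarith)

/-- The supremum and the `L¹` norm of the square root of the Christoffel function grow
polynomially. -/
theorem IsDataSpace.exists_sqrt_christoffel_le [BorelSpace X] (hΞ : Ξ.IsDataSpace q) :
    ∃ c P : ℝ, 0 < c ∧ 0 < P ∧ ∀ᶠ n : ℝ in atTop,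
      (∀ x, ENNReal.ofReal √(Ξ.christoffel n x) ≤ ENNReal.ofReal (c * n ^ P)) ∧
      ∫⁻ x, ENNReal.ofReal √(Ξ.christoffel n x) ∂Ξ.μ ≤ ENNReal.ofReal (c * n ^ P) := by
  obtain ⟨C, hC, hchr⟩ := hΞ.exists_christoffel_le
  obtain ⟨κ, hκ, hμ⟩ := hΞ.exists_measure_le_of_isCompact
  obtain ⟨K, hK, ⟨c₁, c₂, hc₁, hc₂, hdiam⟩, -, hint⟩ := hΞ.essential_compactness
  have hq := hΞ.one_le_q
  refine ⟨√C * κ * (c₁ + 1) ^ q + 1 + √C, q + c₂ * q, by positivity, by positivity, ?_⟩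
  filter_upwards [eventually_ge_atTop 1,
    (hint 1 one_pos).eventually (gt_mem_nhds (zero_lt_one' ℝ≥0∞))] with n hn hsmall
  have hn0 : 0 < n := by linarith
  set P := q + c₂ * q with hP
  have hnP : 1 ≤ n ^ P := Real.one_le_rpow hn (by positivity)
  have hnq : n ^ q ≤ n ^ P := Real.rpow_le_rpow_of_exponent_le hn (by
    have : 0 ≤ c₂ * q := by positivity
    linarith)
  have hsup (x : X) : √(Ξ.christoffel n x) ≤ √C * n ^ q := by
    refine (Real.sqrt_le_sqrt (hchr n hn x)).trans ?_
    rw [Real.sqrt_mul hC.le]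
    gcongr
    have h1 : 1 ≤ n ^ q := Real.one_le_rpow hn (by linarith)
    exact Real.sqrt_le_iff.2 ⟨by positivity, by nlinarith⟩
  have hA0 : 0 ≤ √C * κ * (c₁ + 1) ^ q := by positivity
  constructor
  · intro x
    refine ENNReal.ofReal_le_ofReal ((hsup x).trans ?_)
    have : √C * n ^ q ≤ √C * n ^ P := by gcongr
    have : 0 ≤ (√C * κ * (c₁ + 1) ^ q + 1) * n ^ P := by positivity
    linarith
  have hd : Metric.diam (K n) ≤ c₁ * n ^ c₂ :=
    (ENNReal.ofReal_le_ofReal_iff (by positivity)).1 (hdiam n hn)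
  have hin : ∫⁻ x in K n, ENNReal.ofReal √(Ξ.christoffel n x) ∂Ξ.μ ≤
      ENNReal.ofReal (√C * κ * (c₁ + 1) ^ q * n ^ P) := by
    calc _ ≤ ∫⁻ x in K n, ENNReal.ofReal (√C * n ^ q) ∂Ξ.μ :=
          lintegral_mono fun x => ENNReal.ofReal_le_ofReal (hsup x)
      _ = ENNReal.ofReal (√C * n ^ q) * Ξ.μ (K n) := setLIntegral_const _ _
      _ ≤ ENNReal.ofReal (√C * n ^ q) * ENNReal.ofReal (κ * (Metric.diam (K n) + 1) ^ q) := by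
          gcongr
          exact hμ _ (hK n hn)
      _ ≤ _ := by
          rw [← ENNReal.ofReal_mul (by positivity)]
          refine ENNReal.ofReal_le_ofReal ?_
          have h1 : 1 ≤ n ^ c₂ := Real.one_le_rpow hn hc₂.le
          have h2 : Metric.diam (K n) + 1 ≤ (c₁ + 1) * n ^ c₂ := by linarith
          have h3 : 0 ≤ Metric.diam (K n) := Metric.diam_nonneg
          calc _ ≤ √C * n ^ q * (κ * ((c₁ + 1) * n ^ c₂) ^ q) := by gcongr
            _ = _ := by
              rw [Real.mul_rpow (by positivity) (by positivity), ← Real.rpow_mul hn0.le, hP,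
                Real.rpow_add hn0]
              ring
  have hout : ∫⁻ x in (K n)ᶜ, ENNReal.ofReal √(Ξ.christoffel n x) ∂Ξ.μ ≤
      ENNReal.ofReal (n ^ P) := by
    calc _ ≤ ENNReal.ofReal (n ^ (1 : ℝ)) *
          ∫⁻ x in (K n)ᶜ, ENNReal.ofReal √(Ξ.christoffel n x) ∂Ξ.μ :=
          le_mul_of_one_le_left' (by
            rw [Real.rpow_one]
            exact ENNReal.one_le_ofReal.2 hn)
      _ ≤ 1 := hsmall.le
      _ ≤ _ := ENNReal.one_le_ofReal.2 hnP
  -- On `K n` the supremum times the polynomially bounded measure suffices; off `K n` the integral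
  -- is eventually at most `1`.
  rw [← lintegral_add_compl _ (hK n hn).measurableSet]
  refine (add_le_add hin hout).trans ?_
  rw [← ENNReal.ofReal_add (by positivity) (by positivity)]
  refine ENNReal.ofReal_le_ofReal ?_
  have : 0 ≤ √C * n ^ P := by positivity
  linarith

theorem IsDataSpace.fastDecreasing_eLpNorm_eignetKernel_sub [BorelSpace X] (hΞ : Ξ.IsDataSpace q)
    {h : ℝ → ℝ} (hh : IsLowPassFilter h) {G : X → X → ℝ} {W : X → ℝ} {b : ℝ → ℝ} {B : ℝ}
    (hG : Ξ.IsSmoothKernel G W b B) {ν : ℝ → SignedMeasure X}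
    (hν : Ξ.IsAdmissibleProductQuadrature ν) {p : ℝ≥0∞} (hp : 1 ≤ p) :
    FastDecreasingENNReal (fun n => ⨆ x : X,
      eLpNorm (fun y => Ξ.eignetKernel h b G W n (ν (B * n)) x y - Ξ.locKernel h n x y)
        p Ξ.μ) := by
  intro S hS
  obtain ⟨c, P, hc, hP, hev⟩ := hΞ.exists_sqrt_christoffel_le
  -- `S` cancels the test weight, `P` the Christoffel growth, and the last unit leaves `n⁻¹ → 0`.
  obtain ⟨C, hC, herr⟩ := hΞ.exists_abs_eignetKernel_sub_le hh hG hν (S := S + P + 1) (by positivity)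
  have hlim : Tendsto (fun n : ℝ => ENNReal.ofReal (C * c * n⁻¹)) atTop (𝓝 0) := by
    rw [← ENNReal.ofReal_zero, ← mul_zero (C * c)]
    exact ENNReal.tendsto_ofReal (tendsto_inv_atTop_zero.const_mul _)
  refine tendsto_of_tendsto_of_tendsto_of_le_of_le' tendsto_const_nhds hlim
    (Eventually.of_forall fun _ => zero_le) ?_
  filter_upwards [hev, eventually_ge_atTop 1] with n ⟨hsup, hint⟩ hn
  have hn0 : 0 < n := by linarith
  set E := C * n ^ (-(S + P + 1)) with hE
  have hE0 : 0 ≤ E := by positivity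
  have hpt (x y : X) : ‖Ξ.eignetKernel h b G W n (ν (B * n)) x y - Ξ.locKernel h n x y‖ₑ ≤
      ENNReal.ofReal E * ENNReal.ofReal √(Ξ.christoffel n y) := by
    rw [← ENNReal.ofReal_mul hE0, Real.enorm_eq_ofReal_abs]
    exact ENNReal.ofReal_le_ofReal (herr n hn x y).2
  have hle (x : X) : eLpNorm
      (fun y => Ξ.eignetKernel h b G W n (ν (B * n)) x y - Ξ.locKernel h n x y) p Ξ.μ ≤
        ENNReal.ofReal E * ENNReal.ofReal (c * n ^ P) := by
    refine eLpNorm_le_of_enorm_le_of_lintegral_le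
      (ENNReal.mul_ne_top ENNReal.ofReal_ne_top ENNReal.ofReal_ne_top) (fun y => ?_) ?_ hp
    · exact (hpt x y).trans (mul_le_mul_right (hsup y) _)
    · refine (lintegral_mono (hpt x)).trans ?_
      rw [lintegral_const_mul' _ _ ENNReal.ofReal_ne_top]
      gcongr
  calc _ ≤ ENNReal.ofReal (n ^ S) * (ENNReal.ofReal E * ENNReal.ofReal (c * n ^ P)) := by
        gcongr
        exact iSup_le hle
    _ = ENNReal.ofReal (C * c * n⁻¹) := by
        rw [← ENNReal.ofReal_mul hE0, ← ENNReal.ofReal_mul (by positivity)]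
        congr 1
        have : n ^ S * n ^ (-(S + P + 1)) * n ^ P = n⁻¹ := by
          rw [← Real.rpow_add hn0, ← Real.rpow_add hn0, ← Real.rpow_neg_one]
          congr 1
          ring
        rw [hE, ← this]
        ring

theorem IsDataSpace.exists_abs_eignetKernel_le [BorelSpace X] (hΞ : Ξ.IsDataSpace q)
    {h : ℝ → ℝ} (hh : IsLowPassFilter h) {G : X → X → ℝ} {W : X → ℝ} {b : ℝ → ℝ} {B : ℝ}
    (hG : Ξ.IsSmoothKernel G W b B) {ν : ℝ → SignedMeasure X}
    (hν : Ξ.IsAdmissibleProductQuadrature ν) {S : ℝ} (hS : 0 < S) :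
    ∃ C : ℝ, 0 < C ∧ ∀ n : ℝ, 1 ≤ n → ∀ x y : X,
      |Ξ.eignetKernel h b G W n (ν (B * n)) x y| ≤
        C * (n ^ q / max 1 ((n * dist x y) ^ S) + n ^ (-2 * S)) := by
  obtain ⟨C₁, hC₁, hloc⟩ := hΞ.exists_abs_locKernel_le hh hS
  obtain ⟨C₂, hC₂, hchr⟩ := hΞ.exists_christoffel_le
  have hq := hΞ.one_le_q
  -- The extra `q` absorbs the Christoffel factor in `y`.
  obtain ⟨C₃, hC₃, herr⟩ := hΞ.exists_abs_eignetKernel_sub_le hh hG hν (S := 2 * S + q)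
    (by linarith)
  refine ⟨C₁ + C₃ * √C₂, by positivity, fun n hn x y => ?_⟩
  have hn0 : 0 < n := by linarith
  have hsq : √(Ξ.christoffel n y) ≤ √C₂ * n ^ q := by
    refine (Real.sqrt_le_sqrt (hchr n hn y)).trans ?_
    rw [Real.sqrt_mul hC₂.le]
    gcongr
    have h1 : 1 ≤ n ^ q := Real.one_le_rpow hn (by linarith)
    exact Real.sqrt_le_iff.2 ⟨by positivity, by nlinarith⟩
  have herr' : |Ξ.eignetKernel h b G W n (ν (B * n)) x y - Ξ.locKernel h n x y| ≤
      C₃ * √C₂ * n ^ (-2 * S) := by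
    calc _ ≤ C₃ * n ^ (-(2 * S + q)) * (√C₂ * n ^ q) := by
          refine (herr n hn x y).2.trans ?_
          gcongr
      _ = C₃ * √C₂ * (n ^ (-(2 * S + q)) * n ^ q) := by ring
      _ = _ := by
          rw [← Real.rpow_add hn0]
          congr 2
          ring
  have htri : |Ξ.eignetKernel h b G W n (ν (B * n)) x y| ≤ |Ξ.locKernel h n x y| +
      |Ξ.eignetKernel h b G W n (ν (B * n)) x y - Ξ.locKernel h n x y| := by
    simpa using abs_add_le (Ξ.locKernel h n x y)
      (Ξ.eignetKernel h b G W n (ν (B * n)) x y - Ξ.locKernel h n x y)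
  have := hloc n hn x y
  have : 0 ≤ C₃ * √C₂ * (n ^ q / max 1 ((n * dist x y) ^ S)) := by positivity
  linarith

end SpectralSystem

theorem theorem8p2 {X : Type*} [MetricSpace X] [ConnectedSpace X] [MeasurableSpace X]
    [BorelSpace X] (Ξ : SpectralSystem X) (q : ℝ) (hΞ : Ξ.IsDataSpace q)
    (h : ℝ → ℝ) (hh : IsLowPassFilter h)
    (G : X → X → ℝ) (W : X → ℝ) (b : ℝ → ℝ) (B : ℝ) (hG : Ξ.IsSmoothKernel G W b B)
    (ν : ℝ → SignedMeasure X) (hν : Ξ.IsAdmissibleProductQuadrature ν) :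
    -- the integrals defining the pre-fabricated eignets converge absolutely
    (∀ n : ℝ, 1 ≤ n → ∀ x y : X,
      Integrable (fun z => G x z * W z * Ξ.inverseKernel h b n z y)
        (ν (B * n)).variation) ∧
    (∀ p : ℝ≥0∞, 1 ≤ p →
      FastDecreasingENNReal (fun n => ⨆ x : X,
        eLpNorm (fun y => Ξ.eignetKernel h b G W n (ν (B * n)) x y - Ξ.locKernel h n x y)
          p Ξ.μ)) ∧
    (∀ S : ℝ, 0 < S → ∃ C : ℝ, 0 < C ∧ ∀ n : ℝ, 1 ≤ n → ∀ x y : X,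
      |Ξ.eignetKernel h b G W n (ν (B * n)) x y| ≤
        C * (n ^ q / max 1 ((n * dist x y) ^ S) + n ^ (-2 * S))) := by
  -- Integrability does not depend on the decay exponent, so any positive value serves.
  obtain ⟨_, _, hint⟩ := hΞ.exists_abs_eignetKernel_sub_le hh hG hν one_pos
  exact ⟨fun n hn x y => (hint n hn x y).1,
    fun p hp => hΞ.fastDecreasing_eLpNorm_eignetKernel_sub hh hG hν hp,
    fun S hS => hΞ.exists_abs_eignetKernel_le hh hG hν hS⟩
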